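/- Let $n\ge 1$ and let $k$ be an infinite field in which $(n-1)!\neq 0$ (that is, $\operatorname{char} k=0$ or $\operatorname{char} k\ge n$). Let $C_n=\operatorname{Spec} k[x_1,\dots,x_n]/(x_ix_j : i\neq j)\subset\mathbb A^n_k$ be the union of the $n$ coordinate axes, and let $\hat C_n\subset\hat{\mathbb A}^n_k=\operatorname{Spec} k[[x_1,\dots,x_n]]$ be its formal germ at the origin. If $\pi$ is a map to the plane that is finite on $C_n$ (respectively $\hat C_n$), the divisorial support of $\pi_*\mathcal O_{C_n}$ is the divisor $\sum_p \operatorname{length}\bigl((\pi_*\mathcal O_{C_n})_p\bigr)\,[\overline{p}]$, where $p$ runs over the codimension one points of the plane; let $f(\pi)$ be an equation of it. The ideal of Chow equations of $C_n$ is the ideal generated by the pullbacks $\pi^*f(\pi)$, where $\pi$ runs over one of the following three classes: (a) all linear maps $\pi:\mathbb A^n\to\mathbb A^2$ that are finite on $C_n$ (ideal of $k[x_1,\dots,x_n]$); (b) all polynomial maps $\pi:\mathbb A^n\to\mathbb A^2$ that are finite on $C_n$ (ideal of $k[x_1,\dots,x_n]$); (c) all formal-analytic maps $\pi:\hat{\mathbb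 A}^n\to\hat{\mathbb A}^2$, given by two power series without constant term, that are finite on $\hat C_n$ (ideal of $k[[x_1,\dots,x_n]]$). In each of the three cases the ideal of Chow equations is generated by (1) all monomials of degree $n$ in $x_1,\dots,x_n$ other than $x_1^n,\dots,x_n^n$, if $n$ is even; (2) all monomials of degree $n$ in $x_1,\dots,x_n$ other than $x_1^n,\dots,x_n^n$ and $x_1\cdots x_n$, if $n$ is odd. -/

import Mathlib

noncomputable section

namespace ChowAxes

/-- `f` is an equation of the divisorial support of the `R`-module `M` (for `R` regular in
codimension one): at every codimension one point `p` of `Spec R`, the order of vanishing of `f`,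
that is, the length of `R_p / (f)`, is equal to the length of the stalk `M_p`. In other words,
`div f` is the Weil divisor `∑ length (M_p) [closure of p]`. -/
def IsDivSuppEquation (R M : Type*) [CommRing R] [AddCommGroup M] [Module R M] (f : R) : Prop :=
  ∀ (p : Ideal R) [p.IsPrime], p.height = 1 →
    Module.length (Localization.AtPrime p)
        (Localization.AtPrime p ⧸ Ideal.span {algebraMap R (Localization.AtPrime p) f}) =
      Module.length (Localization.AtPrime p) (LocalizedModule p.primeCompl M)

/-- Let `Y = Spec (A / I)` be a closed subscheme of `Spec A` and let `π : Spec A → Spec R` be the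
morphism given by `φ : R → A`. Then `g ∈ A` is a Chow equation of `Y` for the projection `π` if
`π` is finite on `Y` and `g = π^* f`, where `f` is an equation of the divisorial support
of `π_* 𝒪_Y`. -/
def IsChowEquation {R A : Type*} [CommRing R] [CommRing A] (φ : R →+* A) (I : Ideal A) (g : A) :
    Prop :=
  ((Ideal.Quotient.mk I).comp φ).Finite ∧
    ∃ f : R,
      @IsDivSuppEquation R (A ⧸ I) _ _
        (Module.compHom (A ⧸ I) ((Ideal.Quotient.mk I).comp φ)) f ∧
      g = φ f

variable {k : Type*} [Field k] {n : ℕ}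

/-- The ideal of Chow equations of the curve `V(I) ⊆ 𝔸ⁿ`, using the linear projections
`(P 0, P 1) : 𝔸ⁿ → 𝔸²` that are finite on it (each `P i` is a linear form). -/
def linearChowIdeal (I : Ideal (MvPolynomial (Fin n) k)) : Ideal (MvPolynomial (Fin n) k) :=
  Ideal.span {g | ∃ P : Fin 2 → MvPolynomial (Fin n) k, (∀ i, (P i).IsHomogeneous 1) ∧
    IsChowEquation
      (MvPolynomial.aeval P : MvPolynomial (Fin 2) k →ₐ[k] MvPolynomial (Fin n) k).toRingHom I g}

/-- The ideal of Chow equations of the curve `V(I) ⊆ 𝔸ⁿ`, using all polynomial maps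
`(P 0, P 1) : 𝔸ⁿ → 𝔸²` that are finite on it. -/
def polynomialChowIdeal (I : Ideal (MvPolynomial (Fin n) k)) : Ideal (MvPolynomial (Fin n) k) :=
  Ideal.span {g | ∃ P : Fin 2 → MvPolynomial (Fin n) k,
    IsChowEquation
      (MvPolynomial.aeval P : MvPolynomial (Fin 2) k →ₐ[k] MvPolynomial (Fin n) k).toRingHom I g}

/-- The ideal of Chow equations of the formal curve germ `V(I) ⊆ Spec k⟦x₁, …, xₙ⟧`, using all
formal-analytic maps `(P 0, P 1)` to `Spec k⟦u, v⟧` that send the origin to the origin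
and are finite on the curve germ. -/
def analyticChowIdeal (I : Ideal (MvPowerSeries (Fin n) k)) : Ideal (MvPowerSeries (Fin n) k) :=
  Ideal.span {g | ∃ (P : Fin 2 → MvPowerSeries (Fin n) k)
    (hP : ∀ i, MvPowerSeries.constantCoeff (P i) = 0),
    IsChowEquation
      (MvPowerSeries.substAlgHom (R := k)
        (MvPowerSeries.hasSubst_of_constantCoeff_zero hP)).toRingHom I g}

variable (k n)

/-- The ideal `(xᵢ xⱼ : i ≠ j)` of the union of the `n` coordinate axes in `𝔸ⁿ`. -/
def axesIdeal : Ideal (MvPolynomial (Fin n) k) :=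
  Ideal.span {g | ∃ i j : Fin n, i ≠ j ∧ g = MvPolynomial.X i * MvPolynomial.X j}

/-- The ideal `(xᵢ xⱼ : i ≠ j)` of the germ at the origin of the union of the axes. -/
def formalAxesIdeal : Ideal (MvPowerSeries (Fin n) k) :=
  Ideal.span {g | ∃ i j : Fin n, i ≠ j ∧ g = MvPowerSeries.X i * MvPowerSeries.X j}

/-- The exponents of the degree `n` monomials in `x₁, …, xₙ` other than the `xᵢⁿ` and, if `n` is
odd, other than `x₁ ⋯ xₙ`. -/
def axesExponents : Set (Fin n →₀ ℕ) :=
  {d | d.degree = n ∧ (∀ i, d ≠ Finsupp.single i n) ∧ (Odd n → ¬ ∀ i, d i = 1)}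

end ChowAxes

end

/-! Both inclusions come from restricting to the axes. The ring of the curve embeds in the product
of the rings of its `n` axes, and every tuple of functions vanishing at the origin lifts. So away
from the image of the origin, a point of codimension two, lengths on the curve are sums of lengths
over the axes.

Upper bound. Let `u`, `v` be coordinates centred at the image of the origin. The image of axis `i`
is a plane curve through that point, with some equation `q i`. An equation `f` of the divisorial
support is divisible by a product of `n` factors `a i * u + b i * v`, one per axis: `q i ^ 2` if the
axis contributes length at least two, `q i` otherwise. Each factor pulls back to a series without
constant term that vanishes on axis `i`. Hence the monomials of the pullback of `f` have degree at
least `n` and are not powers of one variable.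

It remains to exclude `x₁ ⋯ xₙ` for `n` odd. Its coefficient is a multiple of the permanent of the
linear parts. Vanishing on axis `i` makes the `i`-th linear part proportional to `V' i * U' j - U' i
* V' j`, with `U'`, `V'` the linear parts of the pullbacks of `u`, `v`. The permanent of a skew
matrix of odd size is zero when `2 ≠ 0`. If `U' i = V' i = 0`, the linear part has to vanish
altogether. This is clear for a square; otherwise the axis is birational onto its image, which must
then be singular because the axis is ramified over it (`mem_span_of_birational`).

Lower bound. For a set `S` of axes and nonzero `y i`, project by the sums of `y i • X i` over `S`
and over its complement. Each axis maps isomorphically onto a coordinate axis, so the product of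
these two forms to the powers `Sᶜ.card` and `S.card` is a Chow equation. Since `k` is infinite, its
terms can be separated by varying `y`; the multinomial coefficients divide products of factorials
that are invertible in `k`. A monomial with exponent `d` is reached once `d i + 1` sums to `n` over
some `S`, and a pigeonhole argument modulo `n` supplies `S` (`exists_sum_add_card_eq`). -/

noncomputable section

namespace ChowAxes

/-! ### Lengths of localized modules and orders of vanishing -/

section Length

variable {R : Type*} [CommRing R]

/-- The cokernel of `f` is killed by `s`, a unit at `p`, so `f` becomes an isomorphism at `p`. -/
theorem length_localizedModule_eq_sum {M ι : Type*} [Fintype ι] {T : ι → Type*}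
    [AddCommGroup M] [Module R M] [∀ i, AddCommGroup (T i)] [∀ i, Module R (T i)]
    (f : M →ₗ[R] Π i, T i) (hf : Function.Injective f) (p : Ideal R) [p.IsPrime]
    {s : R} (hs : s ∉ p) (hsf : ∀ h : Π i, T i, ∃ m, f m = s • h) :
    Module.length (Localization.AtPrime p) (LocalizedModule p.primeCompl M) =
      ∑ i, Module.length (Localization.AtPrime p) (LocalizedModule p.primeCompl (T i)) := by
  rw [← Module.length_pi_of_fintype]
  have e₂ := (IsLocalizedModule.linearEquiv p.primeCompl
    (LocalizedModule.mkLinearMap p.primeCompl (Π i, T i))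
    (.pi fun i ↦ LocalizedModule.mkLinearMap p.primeCompl (T i) ∘ₗ .proj i)
      ).extendScalarsOfIsLocalization p.primeCompl (Localization.AtPrime p)
  rw [← e₂.length_eq]
  refine (LinearEquiv.ofBijective (LocalizedModule.map p.primeCompl f)
    ⟨LocalizedModule.map_injective _ _ hf, fun x ↦ ?_⟩).length_eq
  induction x using LocalizedModule.induction_on with
  | h h t =>
    obtain ⟨m, hm⟩ := hsf h
    refine ⟨LocalizedModule.mk m (⟨s, hs⟩ * t), ?_⟩
    rw [LocalizedModule.map_mk, hm]
    exact LocalizedModule.mk_cancel_common_left ⟨s, hs⟩ t h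

variable {T : Type*} [CommRing T] [Module R T] {ψ : R →+* T}

theorem length_localizedModule_eq_ord (hψ : ∀ (r : R) (t : T), r • t = ψ r * t)
    (hsurj : Function.Surjective ψ) {q : R} (hker : RingHom.ker ψ = Ideal.span {q})
    (p : Ideal R) [p.IsPrime] :
    Module.length (Localization.AtPrime p) (LocalizedModule p.primeCompl T) =
      Ring.ord (Localization.AtPrime p) (algebraMap R (Localization.AtPrime p) q) := by
  let L : Localization.AtPrime p →ₗ[Localization.AtPrime p] LocalizedModule p.primeCompl T :=
    LinearMap.toSpanSingleton _ _ (LocalizedModule.mk (1 : T) 1)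
  have hL (r : R) (s : p.primeCompl) :
      L (IsLocalization.mk' _ r s) = LocalizedModule.mk (ψ r) s := by
    rw [LinearMap.toSpanSingleton_apply, ← Localization.mk_eq_mk', LocalizedModule.mk_smul_mk, hψ,
      mul_one, mul_one]
  have hLs : Function.Surjective L := by
    intro x
    induction x using LocalizedModule.induction_on with
    | h t s =>
      obtain ⟨r, rfl⟩ := hsurj t
      exact ⟨_, hL r s⟩
  have hLk : LinearMap.ker L = Ideal.span {algebraMap R (Localization.AtPrime p) q} := by
    ext x
    obtain ⟨r, s, rfl⟩ := IsLocalization.exists_mk'_eq p.primeCompl x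
    rw [LinearMap.mem_ker, hL, ← LocalizedModule.zero_mk 1, LocalizedModule.mk_eq,
      Ideal.mem_span_singleton']
    constructor
    · rintro ⟨w, hw⟩
      have : (w : R) * r ∈ RingHom.ker ψ := by
        simpa [Submonoid.smul_def, hψ] using hw
      rw [hker, Ideal.mem_span_singleton'] at this
      obtain ⟨a, ha⟩ := this
      refine ⟨IsLocalization.mk' _ a (w * s), ?_⟩
      rw [← IsLocalization.mk'_one (M := p.primeCompl), ← IsLocalization.mk'_mul, ha, mul_one]
      rw [mul_comm (w : R), mul_comm w, IsLocalization.mk'_cancel]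
    · rintro ⟨y, hy⟩
      obtain ⟨a, t, rfl⟩ := IsLocalization.exists_mk'_eq p.primeCompl y
      rw [← IsLocalization.mk'_one (M := p.primeCompl), ← IsLocalization.mk'_mul,
        IsLocalization.mk'_eq_iff_eq, IsLocalization.eq_iff_exists p.primeCompl] at hy
      obtain ⟨c, hc⟩ := hy
      have hq : ψ q = 0 := by
        rw [← RingHom.mem_ker, hker]; exact Ideal.mem_span_singleton_self q
      refine ⟨c * t, ?_⟩
      have := congrArg ψ hc
      simp only [map_mul, hq, mul_zero] at this
      simpa [Submonoid.smul_def, hψ, mul_assoc, eq_comm] using this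
  rw [Ring.ord, ← hLk]
  exact (L.quotKerEquivOfSurjective hLs).length_eq.symm

theorem localizedModule_mk_one_ne_zero (hψ : ∀ (r : R) (t : T), r • t = ψ r * t)
    {p : Ideal R} [p.IsPrime] (hker : RingHom.ker ψ = p) :
    (LocalizedModule.mk 1 1 : LocalizedModule p.primeCompl T) ≠ 0 := by
  intro h
  rw [← LocalizedModule.zero_mk 1, LocalizedModule.mk_eq] at h
  obtain ⟨w, hw⟩ := h
  have : (w : R) ∈ RingHom.ker ψ := by simpa [Submonoid.smul_def, hψ] using hw
  rw [hker] at this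
  exact w.2 this

theorem one_le_length_localizedModule (hψ : ∀ (r : R) (t : T), r • t = ψ r * t)
    {p : Ideal R} [p.IsPrime] (hker : RingHom.ker ψ = p) :
    1 ≤ Module.length (Localization.AtPrime p) (LocalizedModule p.primeCompl T) := by
  rw [Order.one_le_iff_pos, Module.length_pos_iff]
  exact ⟨_, _, localizedModule_mk_one_ne_zero hψ hker⟩

/-- A stalk of length one is simple, hence generated by the class of `1`. So `T` agrees with the
image of `R` at `p`: the branch is birational onto its image. -/
theorem exists_mul_eq_of_length_localizedModule_le_one
    (hψ : ∀ (r : R) (t : T), r • t = ψ r * t)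
    {p : Ideal R} [p.IsPrime] (hker : RingHom.ker ψ = p)
    (h : ¬ 2 ≤ Module.length (Localization.AtPrime p) (LocalizedModule p.primeCompl T)) (t : T) :
    ∃ s ∉ p, ∃ r, ψ s * t = ψ r := by
  have h1 := one_le_length_localizedModule hψ hker
  have h2 : Module.length (Localization.AtPrime p) (LocalizedModule p.primeCompl T) = 1 := by
    refine le_antisymm ?_ h1
    rw [not_le] at h
    exact ENat.lt_add_one_iff (by simp) |>.1 (by rwa [one_add_one_eq_two])
  have hs := Module.length_eq_one_iff.1 h2
  obtain ⟨x, hx⟩ := IsSimpleModule.toSpanSingleton_surjective (Localization.AtPrime p)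
    (localizedModule_mk_one_ne_zero hψ hker)
    (LocalizedModule.mk t 1)
  obtain ⟨r, s, rfl⟩ := IsLocalization.exists_mk'_eq p.primeCompl x
  rw [LinearMap.toSpanSingleton_apply, ← Localization.mk_eq_mk', LocalizedModule.mk_smul_mk,
    LocalizedModule.mk_eq] at hx
  obtain ⟨w, hw⟩ := hx
  refine ⟨w * s, (w * s).2, w * r, ?_⟩
  simpa [Submonoid.smul_def, hψ, mul_assoc, eq_comm] using hw

theorem ord_localization_eq_one {q : R} {p : Ideal R} [p.IsPrime]
    (hp : p = Ideal.span {q}) :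
    Ring.ord (Localization.AtPrime p) (algebraMap R (Localization.AtPrime p) q) = 1 := by
  have hm : Ideal.span {algebraMap R (Localization.AtPrime p) q} =
      IsLocalRing.maximalIdeal (Localization.AtPrime p) := by
    rw [← Localization.AtPrime.map_eq_maximalIdeal, ← Set.image_singleton, ← Ideal.map_span, ← hp]
  rw [Ring.ord, Module.length_eq_one_iff, hm,
    isSimpleModule_iff_isSimpleModule_of_algebraMap_surjective
    (S := _ ⧸ IsLocalRing.maximalIdeal (Localization.AtPrime p)) Ideal.Quotient.mk_surjective]
  let := Ideal.Quotient.field (IsLocalRing.maximalIdeal (Localization.AtPrime p))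
  exact instIsSimpleModule _

/-- Write `f` as a power of `q` times a factor prime to `q`. That factor is a unit at `p`, so the
order is the exponent. -/
theorem pow_dvd_of_le_ord [IsDomain R] [IsNoetherianRing R] {q : R} (hq : Prime q)
    {p : Ideal R} [p.IsPrime] (hp : p = Ideal.span {q}) {f : R} {E : ℕ}
    (h : E ≤ Ring.ord (Localization.AtPrime p) (algebraMap R (Localization.AtPrime p) f)) :
    q ^ E ∣ f := by
  by_cases hf : f = 0
  · simp [hf]
  obtain ⟨j, g, hg, hfg⟩ := WfDvdMonoid.max_power_factor hf hq.irreducible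
  subst hfg
  have hinj := IsLocalization.injective (Localization.AtPrime p) p.primeCompl_le_nonZeroDivisors
  have hq0 : algebraMap R (Localization.AtPrime p) q ∈ nonZeroDivisors _ :=
    mem_nonZeroDivisors_of_ne_zero ((map_ne_zero_iff _ hinj).2 hq.ne_zero)
  have hgu : IsUnit (algebraMap R (Localization.AtPrime p) g) := by
    refine IsLocalization.map_units _ (⟨g, ?_⟩ : p.primeCompl)
    rw [Ideal.mem_primeCompl_iff, hp, Ideal.mem_span_singleton]
    exact hg
  rw [map_mul, map_pow, Ring.ord_mul_of_isUnit_right hgu, Ring.ord_pow hq0,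
    ord_localization_eq_one hp] at h
  have : E ≤ j := by simpa using h
  exact (pow_dvd_pow q this).mul_right g

end Length

/-- `u = v = 0` cuts out a closed point of codimension two at which `u = 0` is integral. -/
structure IsPlanePoint {R : Type*} [CommRing R] (u v : R) : Prop where
  isMaximal : (Ideal.span {u, v}).IsMaximal
  prime : Prime u
  not_dvd : ¬ u ∣ v

/-! ### One smooth branch mapping finitely to the plane -/

section Branch

variable {R T : Type*} [CommRing R] [CommRing T] {u v : R} {ψ : R →+* T} {τ : T}

theorem comap_span_eq (hm : (Ideal.span {u, v}).IsMaximal) (hτ : Prime τ) (hu : τ ∣ ψ u)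
    (hv : τ ∣ ψ v) : (Ideal.span {τ}).comap ψ = Ideal.span {u, v} := by
  refine (hm.eq_of_le ?_ ?_).symm
  · refine Ideal.comap_ne_top _ fun h ↦ hτ.not_isUnit ?_
    exact Ideal.span_singleton_eq_top.1 h
  · rw [Ideal.span_le]
    rintro x (rfl | rfl)
    · exact Ideal.mem_span_singleton.2 hu
    · exact Ideal.mem_span_singleton.2 hv

theorem dvd_map_iff (hm : (Ideal.span {u, v}).IsMaximal) (hτ : Prime τ) (hu : τ ∣ ψ u)
    (hv : τ ∣ ψ v) {r : R} : τ ∣ ψ r ↔ r ∈ Ideal.span {u, v} := by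
  rw [← comap_span_eq hm hτ hu hv, Ideal.mem_comap, Ideal.mem_span_singleton]

variable [IsDomain T]

theorem ker_lt_span [IsPrincipalIdealRing T] (hm : (Ideal.span {u, v}).IsMaximal)
    (hfin : ψ.Finite) (hτ : Prime τ) (hu : τ ∣ ψ u) (hv : τ ∣ ψ v) :
    RingHom.ker ψ < Ideal.span {u, v} := by
  refine lt_of_le_of_ne ?_ fun h ↦ ?_
  · intro r hr
    rw [← dvd_map_iff hm hτ hu hv, (RingHom.mem_ker).1 hr]
    exact dvd_zero _
  · algebraize [ψ]
    have hI : Algebra.IsIntegral R T := ⟨hfin.to_isIntegral⟩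
    have hbot : (⊥ : Ideal T).IsMaximal := by
      refine Ideal.isMaximal_of_isIntegral_of_isMaximal_comap (R := R) _ ?_
      rw [RingHom.algebraMap_toAlgebra]
      change (RingHom.ker ψ).IsMaximal
      rwa [h]
    have := hbot.eq_of_le (J := Ideal.span {τ})
      (fun h ↦ hτ.not_isUnit (Ideal.span_singleton_eq_top.1 h)) bot_le
    exact hτ.ne_zero (Ideal.span_singleton_eq_bot.1 this.symm)

/-- The kernel lies strictly inside an ideal with two generators, so Krull's height theorem bounds
its height by one. If it were zero, some prime of `T` would lie over `(u)` by integrality. That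
prime is nonzero, hence maximal, so `(u)` would be maximal and contain `v`. -/
theorem height_ker_eq_one [IsPrincipalIdealRing T] [IsDomain R] [IsNoetherianRing R]
    (h : IsPlanePoint u v) (hfin : ψ.Finite) (hτ : Prime τ) (hu : τ ∣ ψ u) (hv : τ ∣ ψ v) :
    (RingHom.ker ψ).height = 1 := by
  have hlt := ker_lt_span h.isMaximal hfin hτ hu hv
  have hm := h.isMaximal.isPrime
  have hk : (RingHom.ker ψ).IsPrime := RingHom.ker_isPrime ψ
  apply le_antisymm
  · have h2 : (Ideal.span {u, v}).height ≤ 2 := by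
      refine (Ideal.height_le_spanFinrank _ hm.ne_top).trans ?_
      have := (Submodule.spanFinrank_span_le_ncard_of_finite (R := R)
        (Set.toFinite {u, v})).trans (Set.ncard_insert_le u {v})
      rw [Set.ncard_singleton] at this
      exact_mod_cast this
    have := (Ideal.height_strict_mono_of_isPrime_of_isPrime hlt).trans_le h2
    rw [← one_add_one_eq_two] at this
    exact (ENat.lt_add_one_iff (by simp)).1 this
  · rw [Order.one_le_iff_pos, pos_iff_ne_zero, Ne, Ideal.height_eq_zero_iff_eq_bot]
    intro h0
    algebraize [ψ]
    have hI : Algebra.IsIntegral R T := ⟨hfin.to_isIntegral⟩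
    have hP : (Ideal.span {u}).IsPrime := (Ideal.span_singleton_prime h.prime.ne_zero).2 h.prime
    obtain ⟨Q, hQ, hQu⟩ := Ideal.exists_ideal_over_prime_of_isIntegral_of_isDomain (S := T)
      (Ideal.span {u}) (by rw [RingHom.algebraMap_toAlgebra, h0]; exact bot_le)
    have hQ0 : Q ≠ ⊥ := by
      rintro rfl
      have h1 : u ∈ (⊥ : Ideal T).comap (algebraMap R T) := by
        rw [hQu]; exact Ideal.mem_span_singleton_self u
      have h2 : u ∈ RingHom.ker ψ := h1
      rw [h0] at h2
      exact h.prime.ne_zero h2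
    have hQm := IsPrime.to_maximal_ideal hQ0
    have hu := Ideal.isMaximal_comap_of_isIntegral_of_isMaximal (R := R) Q
    rw [hQu] at hu
    have := hu.eq_of_le hm.ne_top (Ideal.span_mono (by simp))
    refine h.not_dvd (Ideal.mem_span_singleton.1 ?_)
    rw [this]
    exact Ideal.subset_span (by simp)

/-- A plane curve with nonzero linear term is regular at the point, hence normal there, so a
birational finite branch is unramified over it. This contradicts `u` and `v` both vanishing to order
two along the branch. -/
theorem mem_span_of_birational [IsNoetherianRing R] (hm : (Ideal.span {u, v}).IsMaximal)
    (hfin : ψ.Finite) (hτ : Prime τ) (hu : τ ^ 2 ∣ ψ u) (hv : τ ^ 2 ∣ ψ v)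
    (hbir : ∀ t, ∃ s ∉ RingHom.ker ψ, ∃ r, ψ s * t = ψ r) {a b : R}
    (hab : ψ (a * u + b * v) = 0) : a ∈ Ideal.span {u, v} := by
  by_contra ha
  have hu' := (dvd_pow_self τ two_ne_zero).trans hu
  have hv' := (dvd_pow_self τ two_ne_zero).trans hv
  have hdvd {r : R} := dvd_map_iff (r := r) hm hτ hu' hv'
  set m := Ideal.span {u, v} with hmdef
  have := hm.isPrime
  let K := FractionRing T
  have hS (s : m.primeCompl) : IsUnit (((algebraMap T K).comp ψ) s) := by
    rw [isUnit_iff_ne_zero, RingHom.comp_apply, Ne, FaithfulSMul.algebraMap_eq_zero_iff]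
    intro h
    exact s.2 (hdvd.1 (h ▸ dvd_zero τ))
  let L : Localization.AtPrime m →+* K := IsLocalization.lift hS
  have hL (r : R) : L (algebraMap _ _ r) = algebraMap T K (ψ r) := IsLocalization.lift_eq hS r
  -- The local ring of the image curve, inside the function field of the branch.
  let D := L.range
  let L' : Localization.AtPrime m →+* D := L.rangeRestrict
  have hL' : Function.Surjective L' := L.rangeRestrict_surjective
  have : IsLocalRing D := IsLocalRing.of_surjective' L' hL'
  have : IsNoetherianRing D := isNoetherianRing_of_surjective _ _ L' hL'
  -- With `a` a unit at `m`, the relation expresses `u` through `v`, so `v` alone generates the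
  -- maximal ideal.
  have hprin : (IsLocalRing.maximalIdeal D).IsPrincipal := by
    have h1 : IsLocalRing.maximalIdeal D =
        Ideal.span {L' (algebraMap _ _ u), L' (algebraMap _ _ v)} := by
      rw [← IsLocalRing.map_maximalIdeal_of_surjective L' hL',
        ← Localization.AtPrime.map_eq_maximalIdeal, Ideal.map_map]
      conv_lhs => arg 2; rw [hmdef]
      rw [Ideal.map_span, Set.image_pair]
      rfl
    have h2 : L' (algebraMap _ _ a) * L' (algebraMap _ _ u) +
        L' (algebraMap _ _ b) * L' (algebraMap _ _ v) = 0 := by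
      rw [← map_mul, ← map_mul, ← map_mul, ← map_mul, ← map_add, ← map_add]
      apply Subtype.ext
      change L _ = 0
      rw [hL, hab, map_zero]
    have h3 : IsUnit (L' (algebraMap _ _ a)) :=
      (IsLocalization.map_units _ (⟨a, ha⟩ : m.primeCompl)).map L'
    obtain ⟨c, hc⟩ := h3.exists_left_inv
    have h4 : L' (algebraMap _ _ u) ∈ Ideal.span {L' (algebraMap _ _ v)} := by
      rw [Ideal.mem_span_singleton']
      exact ⟨-c * L' (algebraMap _ _ b), by linear_combination -c * h2 + L' (algebraMap _ _ u) * hc⟩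
    refine ⟨L' (algebraMap _ _ v), ?_⟩
    rw [h1, Ideal.submodule_span_eq]
    refine le_antisymm (Ideal.span_le.2 ?_) (Ideal.span_mono (by simp))
    rintro x (rfl | rfl)
    · exact h4
    · exact Ideal.mem_span_singleton_self _
  have hic : IsIntegrallyClosed D :=
    by
    have := (tfae_of_isNoetherianRing_of_isLocalRing_of_isDomain D).out 4 3
    exact (this.1 hprin).1
  have : IsFractionRing D K := by
    refine IsFractionRing.of_field D K fun z ↦ ?_
    obtain ⟨x, y, hy, rfl⟩ := IsFractionRing.div_surjective (A := T) z
    obtain ⟨s, hs, r, hr⟩ := hbir x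
    obtain ⟨s', hs', r', hr'⟩ := hbir y
    refine ⟨L' (algebraMap _ _ (r * s')), L' (algebraMap _ _ (s * r')), ?_⟩
    change _ = L _ / L _
    have h0 {t : T} : t ≠ 0 → algebraMap T K t ≠ 0 := by
      rw [Ne, Ne, FaithfulSMul.algebraMap_eq_zero_iff]; exact id
    have := h0 (mt RingHom.mem_ker.2 hs)
    have := h0 (mt RingHom.mem_ker.2 hs')
    have := h0 (nonZeroDivisors.ne_zero hy)
    rw [hL, hL, map_mul, map_mul ψ s, ← hr, ← hr']
    simp only [map_mul]
    rw [div_eq_div_iff ‹_› (mul_ne_zero ‹_› (mul_ne_zero ‹_› ‹_›))]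
    ring
  have hint : IsIntegral D (algebraMap T K τ) := by
    algebraize [ψ]
    have h1 : IsIntegral R τ := hfin.to_isIntegral τ
    refine h1.map_of_comp_eq (L'.comp (algebraMap _ _)) (algebraMap T K) ?_
    ext r
    exact hL r
  obtain ⟨y, hy⟩ := IsIntegrallyClosed.isIntegral_iff.1 hint
  obtain ⟨x, rfl⟩ := hL' y
  obtain ⟨r, s, rfl⟩ := IsLocalization.exists_mk'_eq m.primeCompl x
  have h1 : ψ s * τ = ψ r := by
    apply FaithfulSMul.algebraMap_injective T K
    rw [map_mul, ← hy, ← hL, ← hL]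
    change L _ * L _ = _
    rw [← map_mul, IsLocalization.mk'_spec'_mk]
  -- By normality `τ` is a fraction `r / s` with `s` outside `m`. Its numerator lies in `m`, whose
  -- image is divisible by `τ ^ 2`, which forces `τ` to divide `ψ s`.
  have h2 : τ ^ 2 ∣ ψ r := by
    have : r ∈ m := hdvd.1 ⟨ψ s, by rw [← h1, mul_comm]⟩
    obtain ⟨c, d, rfl⟩ := Ideal.mem_span_pair.1 this
    rw [map_add, map_mul, map_mul]
    exact dvd_add (hu.mul_left _) (hv.mul_left _)
  rw [← h1, pow_two] at h2
  exact s.2 (hdvd.1 ((mul_dvd_mul_iff_right hτ.ne_zero).1 h2))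

end Branch

/-- The ring `T` seen as a module over `R` through `ψ`. -/
def Along {R T : Type*} [CommRing R] [CommRing T] (_ : R →+* T) : Type _ := T

namespace Along

variable {R T : Type*} [CommRing R] [CommRing T] (ψ : R →+* T)

instance : CommRing (Along ψ) := inferInstanceAs (CommRing T)

instance : Module R (Along ψ) := Module.compHom T ψ

/-- The map `ψ`, with values in `Along ψ`. -/
def hom : R →+* Along ψ := ψ

theorem smul_eq (r : R) (t : Along ψ) : r • t = hom ψ r * t := rfl

end Along

/-! ### The divisorial support of a union of axes -/

section Axes

variable {R A T ι : Type*} [CommRing R] [CommRing A] [CommRing T] [Fintype ι] {u v : R} {τ : T}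
  {r : ι → A →+* T} {φ : R →+* A} {I : Ideal A}

/-- Since `u` and `v` restrict to multiples of `τ` and such tuples lift, both kill the cokernel of
`A ⧸ I` in the product of the axes. One of them is invertible at `p`. -/
theorem length_localizedModule_quotient (hI : ∀ a, a ∈ I ↔ ∀ i, r i a = 0)
    (hlift : ∀ h : ι → T, ∃ a, ∀ i, r i a = τ * h i)
    (hu : ∀ i, τ ∣ r i (φ u)) (hv : ∀ i, τ ∣ r i (φ v)) (p : Ideal R) [p.IsPrime]
    (hp : ¬ (u ∈ p ∧ v ∈ p)) [Module R (A ⧸ I)]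
    (hM : ∀ (x : R) (m : A ⧸ I), x • m = Ideal.Quotient.mk I (φ x) * m) :
    Module.length (Localization.AtPrime p) (LocalizedModule p.primeCompl (A ⧸ I)) =
      ∑ i, Module.length (Localization.AtPrime p)
        (LocalizedModule p.primeCompl (Along ((r i).comp φ))) := by
  let F (i : ι) : A ⧸ I →+* T := Ideal.Quotient.lift I (r i) fun a ha ↦ (hI a).1 ha i
  let f : A ⧸ I →ₗ[R] Π i, Along ((r i).comp φ) :=
    { toFun m i := F i m
      map_add' a b := funext fun i ↦ map_add (F i) a b
      map_smul' x a := funext fun i ↦ by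
        rw [hM, map_mul]
        rfl }
  have hf (a : A) (i : ι) : f (Ideal.Quotient.mk I a) i = r i a := rfl
  have key (s : R) (hs : ∀ i, τ ∣ r i (φ s)) (h : Π i, Along ((r i).comp φ)) :
      ∃ m, f m = s • h := by
    choose c hc using hs
    let h' : ι → T := h
    obtain ⟨a, ha⟩ := hlift fun i ↦ c i * h' i
    refine ⟨Ideal.Quotient.mk I a, funext fun i ↦ ?_⟩
    rw [hf, ha, ← mul_assoc, ← hc]
    rfl
  have hinj : Function.Injective f := by
    rw [injective_iff_map_eq_zero]
    intro m hm
    obtain ⟨a, rfl⟩ := Ideal.Quotient.mk_surjective m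
    rw [Ideal.Quotient.eq_zero_iff_mem, hI]
    exact fun i ↦ congrFun hm i
  rcases not_and_or.1 hp with h | h
  · exact length_localizedModule_eq_sum f hinj p h (key u hu)
  · exact length_localizedModule_eq_sum f hinj p h (key v hv)

theorem exists_prod_dvd [IsDomain R] [IsNoetherianRing R] [UniqueFactorizationMonoid R]
    [IsDomain T] [IsPrincipalIdealRing T]
    (hI : ∀ a, a ∈ I ↔ ∀ i, r i a = 0) (hr : ∀ i, Function.Surjective (r i))
    (hlift : ∀ h : ι → T, ∃ a, ∀ i, r i a = τ * h i) (hτ : Prime τ) (h : IsPlanePoint u v)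
    (hu : ∀ i, τ ∣ r i (φ u)) (hv : ∀ i, τ ∣ r i (φ v))
    (hfin : ((Ideal.Quotient.mk I).comp φ).Finite) {f : R}
    (hf : @IsDivSuppEquation R (A ⧸ I) _ _
        (Module.compHom (A ⧸ I) ((Ideal.Quotient.mk I).comp φ)) f) :
    ∃ a b : ι → R, ∏ i, (a i * u + b i * v) ∣ f ∧ ∀ i, r i (φ (a i * u + b i * v)) = 0 ∧
      (τ ^ 2 ∣ r i (φ u) → τ ^ 2 ∣ r i (φ v) →
        a i ∈ Ideal.span {u, v} ∧ b i ∈ Ideal.span {u, v}) := by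
  classical
  let ψ (i : ι) : R →+* T := (r i).comp φ
  let p (i : ι) : Ideal R := RingHom.ker (ψ i)
  have hψ (i : ι) : (ψ i).Finite := by
    let F : A ⧸ I →+* T := Ideal.Quotient.lift I (r i) fun a ha ↦ (hI a).1 ha i
    have hF : Function.Surjective F := Ideal.Quotient.lift_surjective_of_surjective _ _ (hr i)
    exact (RingHom.Finite.of_surjective F hF).comp hfin
  have hpp (i : ι) : (p i).IsPrime := RingHom.ker_isPrime (ψ i)
  have hp1 (i : ι) : (p i).height = 1 := height_ker_eq_one h (hψ i) hτ (hu i) (hv i)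
  have hlt (i : ι) : p i < Ideal.span {u, v} := ker_lt_span h.isMaximal (hψ i) hτ (hu i) (hv i)
  -- The generator is chosen as a function of the ideal, so axes with the same image share the same
  -- equation and their exponents can be added.
  let g (P : Ideal R) : R := Classical.epsilon fun x ↦ P = Ideal.span {x}
  have hg (i : ι) : p i = Ideal.span {g (p i)} := by
    obtain ⟨x, hx⟩ := UniqueFactorizationMonoid.isPrincipal_of_height_eq_one (hp1 i)
    exact Classical.epsilon_spec (p := fun x ↦ p i = Ideal.span {x}) ⟨x, hx⟩
  have hgp (i : ι) : Prime (g (p i)) := by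
    have h0 : g (p i) ≠ 0 := by
      intro h0
      have := hg i
      rw [h0, Ideal.span_singleton_eq_bot.2 rfl] at this
      exact (p i).ne_bot_of_height_eq_one (hp1 i) this
    rw [← Ideal.span_singleton_prime h0, ← hg]
    exact hpp i
  let ℓ (i : ι) : ℕ∞ := Module.length (Localization.AtPrime (p i))
    (LocalizedModule (p i).primeCompl (Along (ψ i)))
  -- Lengths are truncated at two: a square already has no linear part.
  let δ (i : ι) : ℕ := if 2 ≤ ℓ i then 2 else 1
  have hδ (i : ι) : (δ i : ℕ∞) ≤ ℓ i := by
    by_cases h2 : 2 ≤ ℓ i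
    · simp [δ, h2]
    · simpa [δ, h2] using one_le_length_localizedModule (Along.smul_eq (ψ i)) (p := p i) rfl
  -- Group the axes by image. Distinct images have coprime equations; within a group, the order of
  -- `f` is at least the sum of the lengths.
  have hdvd : ∏ i, g (p i) ^ δ i ∣ f := by
    rw [← Finset.prod_fiberwise_of_maps_to (t := Finset.univ.image p) (g := p) (by simp)]
    refine Finset.prod_dvd_of_isRelPrime ?_ ?_
    · intro P hP Q hQ hPQ
      simp only [Finset.coe_image, Finset.coe_univ, Set.image_univ, Set.mem_range] at hP hQ
      obtain ⟨i, rfl⟩ := hP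
      obtain ⟨j, rfl⟩ := hQ
      refine IsRelPrime.prod_left fun k hk ↦ IsRelPrime.prod_right fun l hl ↦ ?_
      rw [(Finset.mem_filter.1 hk).2, (Finset.mem_filter.1 hl).2]
      refine IsRelPrime.pow ?_
      rw [(hgp i).irreducible.isRelPrime_iff_not_dvd]
      intro hij
      apply hPQ
      rw [hg i, hg j, Ideal.span_singleton_eq_span_singleton]
      exact (hgp i).associated_of_dvd (hgp j) hij
    · intro P hP
      obtain ⟨i, -, rfl⟩ := Finset.mem_image.1 hP
      have e : ∏ k with p k = p i, g (p k) ^ δ k = g (p i) ^ ∑ k with p k = p i, δ k := by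
        rw [← Finset.prod_pow_eq_pow_sum]
        refine Finset.prod_congr rfl fun k hk ↦ ?_
        rw [(Finset.mem_filter.1 hk).2]
      rw [e]
      refine pow_dvd_of_le_ord (hgp i) (hg i) ?_
      let _ : Module R (A ⧸ I) := Module.compHom (A ⧸ I) ((Ideal.Quotient.mk I).comp φ)
      have hnot : ¬ (u ∈ p i ∧ v ∈ p i) := by
        rintro ⟨h1, h2⟩
        refine (hlt i).not_ge (Ideal.span_le.2 ?_)
        rintro x (rfl | rfl)
        exacts [h1, h2]
      rw [Ring.ord, hf (p i) (hp1 i),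
        length_localizedModule_quotient hI hlift hu hv (p i) hnot fun x m ↦ rfl]
      push_cast
      refine le_trans (Finset.sum_le_sum fun k hk ↦ ?_)
        (Finset.sum_le_sum_of_subset (Finset.filter_subset (fun k ↦ p k = p i) Finset.univ))
      have hk' : p k = p i := (Finset.mem_filter.1 hk).2
      refine (hδ k).trans (le_of_eq ?_)
      have hlen (P Q : Ideal R) [P.IsPrime] [Q.IsPrime] (hPQ : P = Q) :
          Module.length (Localization.AtPrime P) (LocalizedModule P.primeCompl (Along (ψ k))) =
            Module.length (Localization.AtPrime Q) (LocalizedModule Q.primeCompl (Along (ψ k))) := by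
        subst hPQ
        rfl
      exact hlen _ _ hk'
  have hmem (i : ι) : g (p i) ∈ Ideal.span {u, v} := by
    exact (hlt i).le ((hg i).ge (Ideal.mem_span_singleton_self _))
  have hgk (i : ι) : ψ i (g (p i)) = 0 := by
    rw [← RingHom.mem_ker]
    change g (p i) ∈ p i
    exact (hg i).ge (Ideal.mem_span_singleton_self _)
  have hab (i : ι) : ∃ a b, g (p i) ^ δ i = a * u + b * v ∧ (τ ^ 2 ∣ ψ i u → τ ^ 2 ∣ ψ i v →
      a ∈ Ideal.span {u, v} ∧ b ∈ Ideal.span {u, v}) := by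
    obtain ⟨a, b, e⟩ := Ideal.mem_span_pair.1 (hmem i)
    by_cases h2 : 2 ≤ ℓ i
    · refine ⟨a * g (p i), b * g (p i), ?_, fun _ _ ↦
        ⟨Ideal.mul_mem_left _ _ (hmem i), Ideal.mul_mem_left _ _ (hmem i)⟩⟩
      simp only [δ, h2, if_true]
      linear_combination -g (p i) * e
    · refine ⟨a, b, by simp [δ, h2, e], fun hu2 hv2 ↦ ?_⟩
      have hbir := exists_mul_eq_of_length_localizedModule_le_one (Along.smul_eq (ψ i))
        (p := p i) rfl h2
      have e' : ψ i (a * u + b * v) = 0 := by rw [e, hgk]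
      refine ⟨mem_span_of_birational h.isMaximal (hψ i) hτ hu2 hv2 hbir e', ?_⟩
      rw [Set.pair_comm]
      rw [add_comm] at e'
      have hm' := h.isMaximal
      rw [Set.pair_comm] at hm'
      exact mem_span_of_birational hm' (hψ i) hτ hv2 hu2 hbir e'
  choose a b hab1 hab2 using hab
  refine ⟨a, b, ?_, fun i ↦ ⟨?_, hab2 i⟩⟩
  · simpa only [hab1] using hdvd
  · rw [← hab1]
    change ψ i _ = 0
    rw [map_pow, hgk, zero_pow]
    dsimp only [δ]
    split_ifs <;> norm_num

end Axes

/-! ### Divisibility by the allowed monomials -/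

section Exponents

variable {n : ℕ}

theorem exists_ne_zero_of_ne_single {d : Fin n →₀ ℕ} (hn : 1 ≤ n)
    (hpure : ∀ i m, d ≠ Finsupp.single i m) : ∃ i j, i ≠ j ∧ d i ≠ 0 ∧ d j ≠ 0 := by
  obtain ⟨i, hi⟩ : ∃ i, d i ≠ 0 := by
    by_contra! h
    exact hpure ⟨0, hn⟩ 0 (Finsupp.ext fun j ↦ by simp [h j])
  by_contra! h
  refine hpure i (d i) (Finsupp.ext fun j ↦ ?_)
  by_cases hj : j = i
  · subst hj; simp
  · rw [h i j (Ne.symm hj) hi, Finsupp.single_eq_of_ne hj]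

theorem single_add_single_le {d : Fin n →₀ ℕ} {i j : Fin n} (hij : i ≠ j) (hi : d i ≠ 0)
    (hj : d j ≠ 0) : Finsupp.single i 1 + Finsupp.single j 1 ≤ d := by
  intro l
  simp only [Finsupp.add_apply, Finsupp.single_apply]
  split_ifs with h1 h2 h2
  · exact absurd (h1.trans h2.symm) hij
  · subst h1; omega
  · subst h2; omega
  · omega

/-- Cut `d` down to degree `n` while keeping two of its variables. The only bad outcome is `x₁ ⋯ xₙ`
with `n` odd; then some exponent of `d` is at least two, and one variable can be traded for another.
-/
theorem exists_mem_axesExponents_le {d : Fin n →₀ ℕ} (hn : 1 ≤ n) (hd : n ≤ d.degree)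
    (hpure : ∀ i m, d ≠ Finsupp.single i m) (hone : Odd n → ¬ ∀ i, d i = 1) :
    ∃ e ∈ axesExponents n, e ≤ d := by
  classical
  rcases hd.eq_or_lt with hd | hd
  · exact ⟨d, ⟨hd.symm, fun i ↦ hpure i n, hone⟩, le_rfl⟩
  obtain ⟨i, j, hij, hi, hj⟩ := exists_ne_zero_of_ne_single hn hpure
  have hn2 : 2 ≤ n := by
    by_contra h
    have : n = 1 := by omega
    subst this
    exact hij (Subsingleton.elim _ _)
  obtain ⟨c, hc⟩ := exists_add_of_le (single_add_single_le hij hi hj)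
  have hdc : d.degree = 2 + c.degree := by
    rw [hc]; simp
  obtain ⟨c', hcc', hc'⟩ := c.exists_le_degree_eq (n - 2) (by omega)
  set e := Finsupp.single i 1 + Finsupp.single j 1 + c' with he
  have hed : e ≤ d := by
    rw [hc, he]
    gcongr
  have hedeg : e.degree = n := by
    rw [he]; simp; omega
  have hei : e i ≠ 0 := by simp [he]
  have hej : e j ≠ 0 := by simp [he]
  have hepure (l : Fin n) : e ≠ Finsupp.single l n := by
    intro h
    have h1 : l = i := by
      by_contra hl
      exact hei (by rw [h, Finsupp.single_eq_of_ne (Ne.symm hl)])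
    have h2 : l = j := by
      by_contra hl
      exact hej (by rw [h, Finsupp.single_eq_of_ne (Ne.symm hl)])
    exact hij (h1.symm.trans h2)
  by_cases hodd : Odd n ∧ ∀ l, e l = 1
  swap
  · exact ⟨e, ⟨hedeg, hepure, fun h1 h2 ↦ hodd ⟨h1, h2⟩⟩, hed⟩
  obtain ⟨hodd, hones⟩ := hodd
  have hn3 : 3 ≤ n := by
    rcases hodd with ⟨m, hm⟩; omega
  obtain ⟨l, hl⟩ : ∃ l, 2 ≤ d l := by
    by_contra! h
    have : d.degree ≤ e.degree := by
      rw [Finsupp.degree_eq_sum, Finsupp.degree_eq_sum]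
      refine Finset.sum_le_sum fun x _ ↦ ?_
      have := h x
      rw [hones x]; omega
    omega
  obtain ⟨a, ha⟩ : ∃ a, a ∉ ({l} : Finset (Fin n)) := by
    by_contra! h
    have := Finset.card_le_card (fun x _ ↦ h x : (Finset.univ : Finset (Fin n)) ⊆ _)
    simp at this; omega
  obtain ⟨b, hb⟩ : ∃ b, b ∉ ({l, a} : Finset (Fin n)) := by
    by_contra! h
    have := Finset.card_le_card (fun x _ ↦ h x : (Finset.univ : Finset (Fin n)) ⊆ _)
    have := this.trans Finset.card_le_two
    simp at this; omega
  simp only [Finset.mem_singleton] at ha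
  simp only [Finset.mem_insert, Finset.mem_singleton, not_or] at hb
  -- Below `d` because `2 ≤ d l`; not a pure power because the third index `b` keeps exponent one.
  let e' : Fin n →₀ ℕ := Finsupp.equivFunOnFinite.symm fun m ↦
    if m = l then 2 else if m = a then 0 else 1
  have he' (m : Fin n) : e' m = if m = l then 2 else if m = a then 0 else 1 := rfl
  have hsum : e' + Finsupp.single a 1 = e + Finsupp.single l 1 := by
    ext m
    simp only [Finsupp.add_apply, Finsupp.single_apply, he', hones]
    grind
  refine ⟨e', ⟨?_, fun x hx ↦ ?_, fun _ h ↦ ?_⟩, fun m ↦ ?_⟩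
  · have := congrArg Finsupp.degree hsum
    simp only [map_add, Finsupp.degree_single] at this
    omega
  · have h1 := DFunLike.congr_fun hx l
    have h2 := DFunLike.congr_fun hx b
    simp only [he', Finsupp.single_apply] at h1 h2
    grind
  · have := h l
    simp [he'] at this
  · have := hed m
    rw [hones] at this
    rw [he']
    split_ifs with h1
    · rwa [h1]
    · omega
    · exact this

end Exponents

/-! ### The permanent of a skew matrix of odd size -/

section Permanent

variable {k : Type*} [Field k] {n : ℕ}

/-- Transposition preserves the permanent, while here it multiplies it by `(-1) ^ n = -1`. -/
theorem sum_perm_eq_zero_of_skew (hn : Odd n) (h2 : (2 : k) ≠ 0) (B : Fin n → Fin n → k)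
    (hB : ∀ i j, B j i = -B i j) (c : Fin n → k) :
    ∑ σ : Equiv.Perm (Fin n), ∏ i, c i * B i (σ i) = 0 := by
  simp only [Finset.prod_mul_distrib, ← Finset.mul_sum]
  let M : Matrix (Fin n) (Fin n) k := Matrix.of fun j i ↦ B i j
  have h1 : M.transpose = (-1 : k) • M := by
    ext i j
    simp [M, hB i j]
  have h3 := M.permanent_transpose
  rw [h1, Matrix.permanent_smul, Fintype.card_fin, hn.neg_one_pow] at h3
  have h4 : M.permanent = 0 := by
    have : (2 : k) * M.permanent = 0 := by linear_combination -h3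
    exact (mul_eq_zero.1 this).resolve_left h2
  change _ * M.permanent = 0
  rw [h4, mul_zero]

end Permanent

/-! ### Coefficients of products of series vanishing on the axes -/

section PowerSeries

open MvPowerSeries

variable {k : Type*} [Field k] {n : ℕ}

/-- The restriction of a power series to the `i`-th coordinate axis. -/
def axis (i : Fin n) : MvPowerSeries (Fin n) k →ₐ[k] PowerSeries k :=
  killCompl ⟨fun _ : Unit ↦ i, fun _ _ _ ↦ rfl⟩

theorem coeff_axis (i : Fin n) (g : MvPowerSeries (Fin n) k) (m : ℕ) :
    PowerSeries.coeff m (axis i g) = coeff (Finsupp.single i m) g := by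
  rw [axis, PowerSeries.coeff, coeff_killCompl, Finsupp.embDomain_single]
  rfl

theorem le_degree_of_coeff_mul_prod_ne_zero {G : MvPowerSeries (Fin n) k}
    {g : Fin n → MvPowerSeries (Fin n) k} (hg : ∀ i, constantCoeff (g i) = 0) {d : Fin n →₀ ℕ}
    (hd : coeff d (G * ∏ i, g i) ≠ 0) : n ≤ d.degree := by
  have h1 : (n : ℕ∞) ≤ (∏ i, g i).order := by
    refine le_trans ?_ (MvPowerSeries.le_order_prod _ _)
    calc (n : ℕ∞) = ∑ _i : Fin n, 1 := by simp
      _ ≤ _ := Finset.sum_le_sum fun i _ ↦ one_le_order_iff_constCoeff_eq_zero.2 (hg i)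
  by_contra! h
  refine hd (coeff_of_lt_order ?_)
  calc (d.degree : ℕ∞) < n := by exact_mod_cast h
    _ ≤ _ := h1
    _ ≤ _ := le_add_self
    _ ≤ _ := le_order_mul

/-- Each factor starts in degree one, so in degree `n` only the constant term of `G` and the linear
parts matter: the coefficient is a multiple of their permanent. -/
theorem coeff_mul_prod_eq_zero {G : MvPowerSeries (Fin n) k}
    {g : Fin n → MvPowerSeries (Fin n) k} (hg : ∀ i, constantCoeff (g i) = 0)
    (hperm : ∑ σ : Equiv.Perm (Fin n), ∏ i, coeff (Finsupp.single (σ i) 1) (g i) = 0)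
    {d : Fin n →₀ ℕ} (hd : ∀ i, d i = 1) : coeff d (G * ∏ i, g i) = 0 := by
  classical
  have hdeg : d.degree = n := by simp [Finsupp.degree_eq_sum, hd]
  have h1 : coeff d (∏ i, g i) = 0 := by
    rw [coeff_prod, ← hperm]
    symm
    refine Finset.sum_of_injOn (fun σ ↦ Finsupp.equivFunOnFinite.symm fun i ↦
      Finsupp.single (σ i) 1) ?_ ?_ ?_ ?_
    · intro σ _ σ' _ h
      ext i
      have := DFunLike.congr_fun h i
      simp only [Finsupp.equivFunOnFinite_symm_apply_apply] at this
      rw [Finsupp.single_left_injective one_ne_zero this]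
    · intro σ _
      simp only [Finset.mem_coe, Finset.mem_finsuppAntidiag, Finset.subset_univ, and_true,
        Finsupp.equivFunOnFinite_symm_apply_apply]
      rw [Equiv.sum_comp σ fun j ↦ Finsupp.single j 1]
      ext j
      simp [Finsupp.finsetSum_apply, Finsupp.single_apply, hd]
    · intro l hl hl'
      by_contra hne
      rw [← Ne, Finset.prod_ne_zero_iff] at hne
      have hsum : ∑ i, l i = d := (Finset.mem_finsuppAntidiag.1 hl).1
      have hpos (i : Fin n) : 1 ≤ (l i).degree := by
        by_contra! h
        have : l i = 0 := (Finsupp.degree_eq_zero_iff _).1 (by omega)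
        refine hne i (Finset.mem_univ _) ?_
        rw [this, coeff_zero_eq_constantCoeff_apply, hg]
      have hle : ∑ i, (l i).degree = ∑ _i : Fin n, 1 := by
        rw [← map_sum, hsum, hdeg]; simp
      have heq (i : Fin n) : (l i).degree = 1 :=
        ((Finset.sum_eq_sum_iff_of_le fun i _ ↦ hpos i).1 hle.symm i (Finset.mem_univ i)).symm
      have hs (i : Fin n) : ∃ j, l i = Finsupp.single j 1 := by
        obtain ⟨j, hj⟩ : ∃ j, l i j ≠ 0 := by
          by_contra! h
          have h0 : l i = 0 := Finsupp.ext h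
          have := heq i
          simp [h0] at this
        obtain ⟨c, hc⟩ := exists_add_of_le (Finsupp.single_le_iff.2 (Nat.one_le_iff_ne_zero.2 hj))
        have h1 := congrArg Finsupp.degree hc
        rw [heq, map_add, Finsupp.degree_single] at h1
        have h2 : c = 0 := (Finsupp.degree_eq_zero_iff _).1 (by omega)
        exact ⟨j, by rw [hc, h2, add_zero]⟩
      choose σ hσ using hs
      have hinj : Function.Surjective σ := by
        intro j
        by_contra! h
        have := DFunLike.congr_fun hsum j
        rw [hd, Finsupp.finsetSum_apply] at this
        simp [hσ, h] at this
      refine hl' ⟨Equiv.ofBijective σ (Finite.injective_iff_bijective.1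
        (Finite.injective_iff_surjective.2 hinj)), Finset.mem_coe.2 (Finset.mem_univ _), ?_⟩
      ext i : 1
      simp [hσ]
    · intro σ _
      simp
  rw [coeff_mul]
  refine Finset.sum_eq_zero fun x hx ↦ ?_
  rw [Finset.HasAntidiagonal.mem_antidiagonal] at hx
  by_cases h0 : x.1 = 0
  · rw [h0, zero_add] at hx
    rw [hx, h1, mul_zero]
  · by_contra hne
    have h2 : coeff x.2 (1 * ∏ i, g i) ≠ 0 := by
      rw [one_mul]
      exact right_ne_zero_of_mul hne
    have h3 := le_degree_of_coeff_mul_prod_ne_zero hg h2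
    have h4 := congrArg Finsupp.degree hx
    rw [map_add, hdeg] at h4
    exact h0 ((Finsupp.degree_eq_zero_iff _).1 (by omega))

theorem coeff_single_one_mul {a U : MvPowerSeries (Fin n) k} (hU : constantCoeff U = 0)
    (j : Fin n) : coeff (Finsupp.single j 1) (a * U) =
      constantCoeff a * coeff (Finsupp.single j 1) U := by
  classical
  rw [coeff_mul, Finsupp.antidiagonal_single]
  simp [Finset.Nat.antidiagonal_succ, hU]

theorem exists_mem_axesExponents_le_of_coeff_ne_zero (hn : 1 ≤ n)
    (hk : ((n - 1).factorial : k) ≠ 0) {G U V : MvPowerSeries (Fin n) k}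
    {a b : Fin n → MvPowerSeries (Fin n) k} (hU : constantCoeff U = 0) (hV : constantCoeff V = 0)
    (haxis : ∀ i, axis i (a i * U + b i * V) = 0)
    (hab : ∀ i, coeff (Finsupp.single i 1) U = 0 → coeff (Finsupp.single i 1) V = 0 →
      constantCoeff (a i) = 0 ∧ constantCoeff (b i) = 0)
    {d : Fin n →₀ ℕ} (hd : coeff d (G * ∏ i, (a i * U + b i * V)) ≠ 0) :
    ∃ e ∈ axesExponents n, e ≤ d := by
  have hg (i : Fin n) : constantCoeff (a i * U + b i * V) = 0 := by simp [hU, hV]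
  have hpure (i : Fin n) (m : ℕ) : d ≠ Finsupp.single i m := by
    rintro rfl
    rw [← coeff_axis, map_mul, map_prod, Finset.prod_eq_zero (Finset.mem_univ i) (haxis i)] at hd
    simp at hd
  refine exists_mem_axesExponents_le hn (le_degree_of_coeff_mul_prod_ne_zero hg hd) hpure
    fun hodd hone ↦ hd (coeff_mul_prod_eq_zero hg ?_ hone)
  -- For `n = 1` the monomial is itself a pure power, already excluded. Otherwise odd `n` is at
  -- least three and `2` divides `(n - 1)!`.
  have h2 : (2 : k) ≠ 0 := by
    have hn3 : 3 ≤ n := by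
      by_contra hn3
      obtain rfl : n = 1 := by
        rcases hodd with ⟨m, hm⟩
        omega
      refine hpure 0 1 ?_
      refine Finsupp.ext fun i ↦ ?_
      rw [hone i, Subsingleton.elim i 0, Finsupp.single_eq_same]
    intro h0
    obtain ⟨c, hc⟩ := Nat.dvd_factorial zero_lt_two (show 2 ≤ n - 1 by omega)
    rw [hc] at hk
    push_cast at hk
    rw [h0, zero_mul] at hk
    exact hk rfl
  let U' (j : Fin n) := coeff (Finsupp.single j 1) U
  let V' (j : Fin n) := coeff (Finsupp.single j 1) V
  have hlin (i j : Fin n) : coeff (Finsupp.single j 1) (a i * U + b i * V) =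
      constantCoeff (a i) * U' j + constantCoeff (b i) * V' j := by
    rw [map_add, coeff_single_one_mul hU, coeff_single_one_mul hV]
  -- The constant terms of `a i`, `b i` are orthogonal to `(U' i, V' i)`, hence proportional to `(V'
  -- i, -U' i)` unless that vector is zero, the case covered by `hab`.
  have hc (i : Fin n) : ∃ c : k, ∀ j, coeff (Finsupp.single j 1) (a i * U + b i * V) =
      c * (V' i * U' j - U' i * V' j) := by
    have h0 : constantCoeff (a i) * U' i + constantCoeff (b i) * V' i = 0 := by
      rw [← hlin, ← coeff_axis, haxis, map_zero]
    by_cases hVi : V' i = 0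
    · by_cases hUi : U' i = 0
      · obtain ⟨h1, h2⟩ := hab i hUi hVi
        exact ⟨0, fun j ↦ by rw [hlin, h1, h2]; ring⟩
      · rw [hVi, mul_zero, add_zero] at h0
        have h1 := (mul_eq_zero.1 h0).resolve_right hUi
        refine ⟨-constantCoeff (b i) / U' i, fun j ↦ ?_⟩
        rw [hlin, h1, hVi]
        field_simp
        ring
    · refine ⟨constantCoeff (a i) / V' i, fun j ↦ ?_⟩
      rw [hlin]
      field_simp
      linear_combination V' j * h0
  choose c hc using hc
  simp only [hc]
  exact sum_perm_eq_zero_of_skew hodd h2 (fun i j ↦ V' i * U' j - U' i * V' j)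
    (fun i j ↦ by ring) c

end PowerSeries

/-! ### A zero-sum problem modulo n -/

section Combinatorics

variable {n : ℕ}

/-- The numbers `d i + 1` are positive with total `2 * n`, so a nonempty proper subset whose sum is
divisible by `n` has sum exactly `n`. If all are equal to `2`, then `n` is even and half of them
suffice. Otherwise take two unequal ones and apply the pigeonhole principle to partial sums. -/
theorem exists_sum_add_card_eq {d : Fin n →₀ ℕ} (hn : 1 ≤ n) (hd : d ∈ axesExponents n) :
    ∃ S : Finset (Fin n), ∑ i ∈ S, d i + S.card = n ∧ 0 < S.card ∧ S.card < n := by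
  classical
  obtain ⟨hdeg, hpure, hone⟩ := hd
  let e (i : Fin n) : ℕ := d i + 1
  have he (S : Finset (Fin n)) : ∑ i ∈ S, e i = ∑ i ∈ S, d i + S.card := by
    simp [e, Finset.sum_add_distrib]
  rw [Finsupp.degree_eq_sum] at hdeg
  have htot : ∑ i, e i = 2 * n := by
    rw [he, hdeg, Finset.card_univ, Fintype.card_fin]; ring
  suffices h : ∃ S : Finset (Fin n), ∑ i ∈ S, e i = n by
    obtain ⟨S, hS⟩ := h
    rw [he] at hS
    refine ⟨S, hS, Finset.card_pos.2 ?_, ?_⟩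
    · rw [Finset.nonempty_iff_ne_empty]
      rintro rfl
      simp at hS
      omega
    · rw [← not_le]
      intro h
      have : S = Finset.univ := Finset.eq_univ_of_card _
        (le_antisymm (Finset.card_le_univ _) (by simpa using h))
      rw [this, hdeg] at hS
      simp at hS
      omega
  have hle (i : Fin n) : e i ≤ n := by
    by_contra! h
    have h1 := Finset.add_sum_erase Finset.univ d (Finset.mem_univ i)
    have h3 : d i = n := by simp only [e] at h; omega
    have h2 : ∑ x ∈ Finset.univ.erase i, d x = 0 := by omega
    refine hpure i (Finsupp.ext fun x ↦ ?_)
    by_cases hx : x = i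
    · subst hx; simp [h3]
    · rw [Finsupp.single_eq_of_ne hx]
      exact Finset.sum_eq_zero_iff.1 h2 x (Finset.mem_erase.2 ⟨hx, Finset.mem_univ x⟩)
  have hprop (S : Finset (Fin n)) (h1 : S.Nonempty) (h2 : S ≠ Finset.univ)
      (h3 : n ∣ ∑ i ∈ S, e i) : ∑ i ∈ S, e i = n := by
    obtain ⟨c, hc⟩ := h3
    have h4 : 0 < ∑ i ∈ S, e i := Finset.sum_pos (fun i _ ↦ Nat.succ_pos _) h1
    have h5 : ∑ i ∈ S, e i < 2 * n := by
      rw [← htot]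
      obtain ⟨x, hx⟩ : ∃ x, x ∉ S := by
        by_contra! h
        exact h2 (Finset.eq_univ_iff_forall.2 h)
      exact Finset.sum_lt_sum_of_subset (Finset.subset_univ S) (Finset.mem_univ x) hx
        (Nat.succ_pos _) fun _ _ _ ↦ Nat.zero_le _
    rw [hc] at h4 h5 ⊢
    have h6 : c < 2 := by
      rw [mul_comm] at h5
      exact lt_of_mul_lt_mul_right h5 (Nat.zero_le n)
    have h7 : c ≠ 0 := by rintro rfl; simp at h4
    obtain rfl : c = 1 := by omega
    simp
  by_cases hall : ∃ i j, e i ≠ e j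
  swap
  · push Not at hall
    have h1 (i : Fin n) : e i = 2 := by
      have : ∑ j, e j = n * e i := by
        rw [Finset.sum_congr rfl fun j _ ↦ hall j i]; simp
      rw [htot, mul_comm] at this
      exact (Nat.eq_of_mul_eq_mul_left (by omega) this).symm
    have h2 : ¬ Odd n := fun h ↦ hone h fun i ↦ by
      have := h1 i
      simp only [e] at this
      omega
    obtain ⟨m, hm⟩ := Nat.not_odd_iff_even.1 h2
    obtain ⟨S, -, hS⟩ := Finset.exists_subset_card_eq (s := (Finset.univ : Finset (Fin n)))
      (n := m) (by simp; omega)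
    refine ⟨S, ?_⟩
    rw [Finset.sum_congr rfl fun i _ ↦ h1 i, Finset.sum_const, hS, smul_eq_mul]
    omega
  obtain ⟨i, j, hij⟩ := hall
  have hne : i ≠ j := fun h ↦ hij (h ▸ rfl)
  have hn2 : 2 ≤ n := by
    have := i.2; have := j.2
    have : (i : ℕ) ≠ j := fun h ↦ hne (Fin.ext h)
    omega
  let z : Fin n := ⟨0, by omega⟩
  let o : Fin n := ⟨1, by omega⟩
  have hzo : o ≠ z := by simp [z, o]
  obtain ⟨σ, hσ0, hσ1⟩ : ∃ σ : Equiv.Perm (Fin n), σ z = i ∧ σ o = j := by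
    have h1 : Equiv.swap z i o ≠ i := by
      intro h
      rw [Equiv.swap_apply_eq_iff, Equiv.swap_apply_right] at h
      exact hzo h
    refine ⟨(Equiv.swap z i).trans (Equiv.swap (Equiv.swap z i o) j), ?_, ?_⟩
    · rw [Equiv.trans_apply, Equiv.swap_apply_left, Equiv.swap_apply_of_ne_of_ne h1.symm hne]
    · rw [Equiv.trans_apply, Equiv.swap_apply_left]
  let B (m : Fin n) : Finset (Fin n) := Finset.univ.filter fun x ↦ σ.symm x < m
  have hB (m x : Fin n) : σ x ∈ B m ↔ x < m := by simp [B]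
  -- The initial segments of an ordering that begins with `i`, `j`, where the useless empty segment
  -- is replaced by `{j}`. Without a solution these `n` sums are distinct and nonzero modulo `n`,
  -- which is one too many.
  let D (m : Fin n) : Finset (Fin n) := if m = z then {j} else B m
  have hz (m : Fin n) (hm : m ≠ z) : z < m := by
    rw [Fin.lt_def]
    exact Nat.pos_of_ne_zero fun h ↦ hm (Fin.ext h)
  have hsub (C C' : Finset (Fin n)) (h : C ⊆ C') (hne : (C' \ C).Nonempty)
      (hnu : ∃ x, x ∉ C')
      (heq : ((∑ i ∈ C, e i : ℕ) : ZMod n) = (∑ i ∈ C', e i : ℕ)) :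
      ∃ S : Finset (Fin n), ∑ i ∈ S, e i = n := by
    refine ⟨C' \ C, hprop _ hne (fun h ↦ ?_) ?_⟩
    · obtain ⟨x, hx⟩ := hnu
      exact hx (Finset.mem_sdiff.1 (h ▸ Finset.mem_univ x)).1
    · rw [← ZMod.natCast_eq_zero_iff]
      have := Finset.sum_sdiff (f := e) h
      rw [← this, Nat.cast_add] at heq
      simpa using heq
  have hlast (m : Fin n) : ∃ x, x ∉ B m := ⟨σ m, by simp [hB]⟩
  by_contra hcon
  have hDne (m : Fin n) : ((∑ i ∈ D m, e i : ℕ) : ZMod n) ≠ 0 := by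
    intro h
    rw [ZMod.natCast_eq_zero_iff] at h
    refine hcon ⟨_, hprop _ ?_ ?_ h⟩
    · by_cases hm : m = z
      · simp [D, hm]
      · exact ⟨σ z, by simp only [D, hm, if_false, hB]; exact hz m hm⟩
    · by_cases hm : m = z
      · simp only [D, hm, if_true]
        intro h
        exact hne (Finset.mem_singleton.1 (h ▸ Finset.mem_univ i))
      · simp only [D, hm, if_false]
        intro h
        obtain ⟨x, hx⟩ := hlast m
        exact hx (h ▸ Finset.mem_univ x)
  have hstart (m : Fin n) (hm : m ≠ z) :
      ((∑ i ∈ D z, e i : ℕ) : ZMod n) ≠ (∑ i ∈ D m, e i : ℕ) := by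
    simp only [D, hm, if_false, if_true]
    intro heq
    by_cases hmo : m = o
    · have hBo : B m = {i} := by
        ext x
        obtain ⟨y, rfl⟩ := σ.surjective x
        rw [hB, Finset.mem_singleton, ← hσ0, σ.injective.eq_iff, hmo]
        simp only [o, z, Fin.lt_def, Fin.ext_iff]
        omega
      -- The only incomparable pair is `{i}`, `{j}`: the two numbers lie between `1` and `n` and
      -- differ, so they are not congruent.
      rw [hBo, Finset.sum_singleton, Finset.sum_singleton, ZMod.natCast_eq_natCast_iff] at heq
      have h1 := hle i
      have h2 := hle j
      have h3 : 0 < e i := Nat.succ_pos _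
      have h4 : 0 < e j := Nat.succ_pos _
      rcases lt_or_gt_of_ne hij with h | h
      · have := Nat.le_of_dvd (by omega) ((Nat.modEq_iff_dvd' h.le).1 heq.symm)
        omega
      · have := Nat.le_of_dvd (by omega) ((Nat.modEq_iff_dvd' h.le).1 heq)
        omega
    · refine hcon (hsub {j} (B m) ?_ ⟨i, ?_⟩ (hlast m) heq)
      · rw [Finset.singleton_subset_iff, ← hσ1, hB]
        have h1 : (m : ℕ) ≠ 0 := fun h ↦ hm (Fin.ext h)
        have h2 : (m : ℕ) ≠ 1 := fun h ↦ hmo (Fin.ext h)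
        rw [Fin.lt_def]
        change 1 < (m : ℕ)
        omega
      · rw [Finset.mem_sdiff, Finset.mem_singleton]
        refine ⟨?_, hne⟩
        rw [← hσ0, hB]
        exact hz m hm
  have hstep (m m' : Fin n) (hm : m ≠ z) (h : m < m') :
      ((∑ i ∈ D m, e i : ℕ) : ZMod n) ≠ (∑ i ∈ D m', e i : ℕ) := by
    have hm' : m' ≠ z := (lt_trans (hz m hm) h).ne'
    simp only [D, hm, hm', if_false]
    intro heq
    refine hcon (hsub (B m) (B m') ?_ ⟨σ m, ?_⟩ (hlast m') heq)
    · intro x hx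
      obtain ⟨y, rfl⟩ := σ.surjective x
      rw [hB] at hx ⊢
      exact hx.trans h
    · simp [hB, h]
  have hinj : Function.Injective fun m ↦ ((∑ i ∈ D m, e i : ℕ) : ZMod n) := by
    intro m m' h
    by_contra hmm
    by_cases hm : m = z
    · subst hm
      exact hstart m' (Ne.symm hmm) h
    by_cases hm' : m' = z
    · subst hm'
      exact hstart m hmm h.symm
    rcases lt_or_gt_of_ne hmm with hlt | hlt
    · exact hstep m m' hm hlt h
    · exact hstep m' m hm' hlt h.symm
  have : NeZero n := ⟨by omega⟩
  have hbij := (Fintype.bijective_iff_injective_and_card _).2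
    ⟨hinj, by rw [Fintype.card_fin, ZMod.card]⟩
  obtain ⟨m, hm⟩ := hbij.2 0
  exact hDne m hm

end Combinatorics

/-! ### Separating monomials over an infinite field -/

section Extraction

variable {k : Type*} [Field k] [Infinite k] {n : ℕ}

/-- Modulo `V`, every linear functional turns the sum into a polynomial in `y` vanishing wherever
all coordinates are nonzero. Such a polynomial is zero over an infinite field. -/
theorem mem_of_forall_sum_smul_mem {W K : Type*} [AddCommGroup W] [Module k W]
    (V : Submodule k W) (s : Finset K) (E : K → Fin n →₀ ℕ) (hE : Set.InjOn E s) (w : K → W)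
    (h : ∀ y : Fin n → k, (∀ i, y i ≠ 0) → ∑ κ ∈ s, (∏ i, y i ^ E κ i) • w κ ∈ V)
    {κ : K} (hκ : κ ∈ s) : w κ ∈ V := by
  classical
  rw [← Submodule.Quotient.mk_eq_zero, ← Module.forall_dual_apply_eq_zero_iff k]
  intro ℓ
  let p : MvPolynomial (Fin n) k := ∑ κ ∈ s, MvPolynomial.monomial (E κ) (ℓ (V.mkQ (w κ)))
  -- The extra factor takes care of the points with a zero coordinate.
  have hp : p * ∏ i, MvPolynomial.X i = 0 := by
    apply MvPolynomial.funext
    intro y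
    by_cases hy : ∀ i, y i ≠ 0
    · have h1 : ℓ (V.mkQ (∑ κ ∈ s, (∏ i, y i ^ E κ i) • w κ)) = 0 := by
        rw [Submodule.mkQ_apply, (Submodule.Quotient.mk_eq_zero V).2 (h y hy), map_zero]
      have h2 : MvPolynomial.eval y p = 0 := by
        rw [← h1]
        simp only [p, map_sum, map_smul, MvPolynomial.eval_monomial, smul_eq_mul]
        refine Finset.sum_congr rfl fun κ _ ↦ ?_
        rw [mul_comm, Finsupp.prod_fintype _ _ fun i ↦ pow_zero _]
      rw [map_mul, h2, zero_mul, map_zero]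
    · push Not at hy
      obtain ⟨i, hi⟩ := hy
      rw [map_mul, map_prod, Finset.prod_eq_zero (Finset.mem_univ i) (by simpa using hi), mul_zero,
        map_zero]
  have hp0 : p = 0 :=
    (mul_eq_zero.1 hp).resolve_right (Finset.prod_ne_zero_iff.2 fun i _ ↦ MvPolynomial.X_ne_zero i)
  have hc : MvPolynomial.coeff (E κ) p = ℓ (V.mkQ (w κ)) := by
    simp only [p, MvPolynomial.coeff_sum, MvPolynomial.coeff_monomial]
    rw [Finset.sum_eq_single_of_mem κ hκ, if_pos rfl]
    intro κ' hκ' hne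
    rw [if_neg fun h ↦ hne (hE hκ' hκ h)]
  rw [hp0, MvPolynomial.coeff_zero] at hc
  exact hc.symm

theorem multinomial_cast_ne_zero {k : Type*} [Field k] {n : ℕ}
    (hk : ((n - 1).factorial : k) ≠ 0) {ι : Type*} {S : Finset ι} {d : ι → ℕ}
    (hS : ∑ i ∈ S, d i < n) : (Nat.multinomial S d : k) ≠ 0 := by
  intro h0
  obtain ⟨c, hc⟩ := Nat.factorial_dvd_factorial (show ∑ i ∈ S, d i ≤ n - 1 by omega)
  rw [hc, ← Nat.multinomial_spec] at hk
  push_cast at hk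
  simp [h0] at hk

theorem prod_pow_mem_of_forall_mem (hk : ((n - 1).factorial : k) ≠ 0) {A : Type*} [CommRing A]
    [Algebra k A] (x : Fin n → A) (V : Submodule k A) (S : Finset (Fin n)) {a b : ℕ}
    (ha : a < n) (hb : b < n)
    (h : ∀ y : Fin n → k, (∀ i, y i ≠ 0) →
      (∑ i ∈ S, y i • x i) ^ a * (∑ i ∈ Sᶜ, y i • x i) ^ b ∈ V)
    {d : Fin n → ℕ} (hda : ∑ i ∈ S, d i = a) (hdb : ∑ i ∈ Sᶜ, d i = b) :
    ∏ i, x i ^ d i ∈ V := by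
  classical
  let s := S.piAntidiag a ×ˢ Sᶜ.piAntidiag b
  let E (κ : (Fin n → ℕ) × (Fin n → ℕ)) : Fin n →₀ ℕ :=
    Finsupp.equivFunOnFinite.symm fun i ↦ if i ∈ S then κ.1 i else κ.2 i
  let w (κ : (Fin n → ℕ) × (Fin n → ℕ)) : A :=
    ((Nat.multinomial S κ.1 : k) * (Nat.multinomial Sᶜ κ.2 : k)) • ∏ i, x i ^ E κ i
  have hE : Set.InjOn E s := by
    rintro ⟨f, g⟩ hfg ⟨f', g'⟩ hfg' heq
    simp only [s, Finset.coe_product, Set.mem_prod, Finset.mem_coe, Finset.mem_piAntidiag] at hfg hfg'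
    have hi (i : Fin n) : (if i ∈ S then f i else g i) = if i ∈ S then f' i else g' i :=
      DFunLike.congr_fun heq i
    refine Prod.ext (funext fun i ↦ ?_) (funext fun i ↦ ?_)
    · by_cases h : i ∈ S
      · simpa [h] using hi i
      · have h1 := mt (hfg.1.2 i) h
        have h2 := mt (hfg'.1.2 i) h
        push Not at h1 h2
        exact h1.trans h2.symm
    · by_cases h : i ∈ S
      · have h1 := mt (hfg.2.2 i) (by simpa using h)
        have h2 := mt (hfg'.2.2 i) (by simpa using h)
        push Not at h1 h2
        exact h1.trans h2.symm
      · simpa [h] using hi i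
  have hsplit (f : Fin n → A) (κ : (Fin n → ℕ) × (Fin n → ℕ)) :
      ∏ i, f i ^ E κ i = (∏ i ∈ S, f i ^ κ.1 i) * ∏ i ∈ Sᶜ, f i ^ κ.2 i := by
    rw [← Finset.prod_mul_prod_compl S]
    congr 1
    · refine Finset.prod_congr rfl fun i hi ↦ ?_
      simp [E, hi]
    · refine Finset.prod_congr rfl fun i hi ↦ ?_
      simp [E, Finset.mem_compl.1 hi]
  let κ : (Fin n → ℕ) × (Fin n → ℕ) :=
    (fun i ↦ if i ∈ S then d i else 0, fun i ↦ if i ∈ S then 0 else d i)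
  have hκ1 : ∑ i ∈ S, κ.1 i = a := by
    rw [← hda]; exact Finset.sum_congr rfl fun i hi ↦ by simp [κ, hi]
  have hκ2 : ∑ i ∈ Sᶜ, κ.2 i = b := by
    rw [← hdb]; exact Finset.sum_congr rfl fun i hi ↦ by simp [κ, Finset.mem_compl.1 hi]
  have hκ : κ ∈ s := by
    simp only [s, Finset.mem_product, Finset.mem_piAntidiag]
    exact ⟨⟨hκ1, fun i hi ↦ by by_contra h; simp [κ, h] at hi⟩,
      hκ2, fun i hi ↦ by by_contra h; simp [κ, Finset.mem_compl] at hi h; exact hi.1 h⟩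
  have hwV : w κ ∈ V := by
    refine mem_of_forall_sum_smul_mem V s E hE w (fun y hy ↦ ?_) hκ
    convert h y hy using 1
    rw [Finset.sum_pow_eq_sum_piAntidiag, Finset.sum_pow_eq_sum_piAntidiag, Finset.sum_mul_sum,
      ← Finset.sum_product']
    refine Finset.sum_congr rfl fun κ _ ↦ ?_
    simp only [w, Algebra.smul_def, map_mul, map_natCast, map_prod, map_pow, hsplit, mul_pow,
      Finset.prod_mul_distrib]
    ring
  have hc : (Nat.multinomial S κ.1 : k) * (Nat.multinomial Sᶜ κ.2 : k) ≠ 0 :=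
    mul_ne_zero (multinomial_cast_ne_zero hk (by omega)) (multinomial_cast_ne_zero hk (by omega))
  have hE' : ∏ i, x i ^ d i = ∏ i, x i ^ E κ i := by
    refine Finset.prod_congr rfl fun i _ ↦ ?_
    by_cases hi : i ∈ S <;> simp [E, κ, hi]
  rw [hE']
  exact (Submodule.smul_mem_iff V hc).1 hwV

end Extraction

/-! ### Bounds common to the polynomial and the formal case -/

section Axes

variable {R A T : Type*} [CommRing R] [CommRing A] [CommRing T] {u v : R} {τ : T}

/-- The maps `α` and `β` expand functions as power series at the origin, so that the polynomial and
the formal case are handled together. -/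
theorem exists_mem_axesExponents_le_of_isDivSuppEquation [IsDomain R] [IsNoetherianRing R]
    [UniqueFactorizationMonoid R] [IsDomain T] [IsPrincipalIdealRing T]
    {k : Type*} [Field k] {n : ℕ} (hn : 1 ≤ n) (hk : ((n - 1).factorial : k) ≠ 0)
    {r : Fin n → A →+* T} {φ : R →+* A} {I : Ideal A}
    (hI : ∀ a, a ∈ I ↔ ∀ i, r i a = 0) (hr : ∀ i, Function.Surjective (r i))
    (hlift : ∀ h : Fin n → T, ∃ a, ∀ i, r i a = τ * h i) (hτ : Prime τ)
    (α : A →+* MvPowerSeries (Fin n) k) (β : T →+* PowerSeries k)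
    (hαβ : ∀ i a, axis i (α a) = β (r i a))
    (hβ : ∀ m t, (∀ l < m, PowerSeries.coeff l (β t) = 0) → τ ^ m ∣ t)
    (h : IsPlanePoint u v) (hu : MvPowerSeries.constantCoeff (α (φ u)) = 0)
    (hv : MvPowerSeries.constantCoeff (α (φ v)) = 0)
    (hfin : ((Ideal.Quotient.mk I).comp φ).Finite) {f : R}
    (hf : @IsDivSuppEquation R (A ⧸ I) _ _
        (Module.compHom (A ⧸ I) ((Ideal.Quotient.mk I).comp φ)) f)
    {d : Fin n →₀ ℕ} (hd : MvPowerSeries.coeff d (α (φ f)) ≠ 0) :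
    ∃ e ∈ axesExponents n, e ≤ d := by
  have hcoeff (i : Fin n) (a : A) (m : ℕ) : PowerSeries.coeff m (β (r i a)) =
      MvPowerSeries.coeff (Finsupp.single i m) (α a) := by
    rw [← hαβ, coeff_axis]
  have hdvd1 (i : Fin n) (a : A) (ha : MvPowerSeries.constantCoeff (α a) = 0) : τ ∣ r i a := by
    rw [← pow_one τ]
    refine hβ 1 _ fun l hl ↦ ?_
    obtain rfl : l = 0 := by omega
    rw [hcoeff, Finsupp.single_zero, MvPowerSeries.coeff_zero_eq_constantCoeff_apply, ha]
  have hdvd2 (i : Fin n) (a : A) (ha : MvPowerSeries.constantCoeff (α a) = 0)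
      (ha1 : MvPowerSeries.coeff (Finsupp.single i 1) (α a) = 0) : τ ^ 2 ∣ r i a := by
    refine hβ 2 _ fun l hl ↦ ?_
    rw [hcoeff]
    obtain rfl | rfl : l = 0 ∨ l = 1 := by omega
    · rw [Finsupp.single_zero, MvPowerSeries.coeff_zero_eq_constantCoeff_apply, ha]
    · exact ha1
  have hzero {a : R} (ha : a ∈ Ideal.span {u, v}) :
      MvPowerSeries.constantCoeff (α (φ a)) = 0 := by
    obtain ⟨x, y, rfl⟩ := Ideal.mem_span_pair.1 ha
    simp [hu, hv]
  obtain ⟨a, b, ⟨c, hc⟩, hab⟩ := exists_prod_dvd hI hr hlift hτ h (fun i ↦ hdvd1 i _ hu)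
    (fun i ↦ hdvd1 i _ hv) hfin hf
  have e : α (φ f) = α (φ c) * ∏ i, (α (φ (a i)) * α (φ u) + α (φ (b i)) * α (φ v)) := by
    rw [hc, mul_comm]
    simp only [map_mul, map_prod, map_add]
  rw [e] at hd
  refine exists_mem_axesExponents_le_of_coeff_ne_zero hn hk hu hv (fun i ↦ ?_) (fun i h1 h2 ↦ ?_) hd
  · rw [← map_mul, ← map_mul, ← map_mul, ← map_mul, ← map_add, ← map_add, hαβ, (hab i).1, map_zero]
  · obtain ⟨h3, h4⟩ := (hab i).2 (hdvd2 i _ hu h1) (hdvd2 i _ hv h2)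
    exact ⟨hzero h3, hzero h4⟩

variable {ι : Type*} [Fintype ι] {r : ι → A →+* T} {φ : R →+* A} {I : Ideal A}

/-- The module is generated by `1` and, for each axis, a function equal to `τ` there and zero on the
others: subtract the common value at the origin, then correct on each axis separately. -/
theorem finite_of_surjective_on_axes (hI : ∀ a, a ∈ I ↔ ∀ i, r i a = 0)
    (hlift : ∀ h : ι → T, ∃ a, ∀ i, r i a = τ * h i)
    (hconst : ∀ a, ∃ c, ∀ i, τ ∣ r i (a - φ c))
    (hψ : ∀ i, Function.Surjective ((r i).comp φ)) :
    ((Ideal.Quotient.mk I).comp φ).Finite := by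
  classical
  have hx (i : ι) : ∃ a, ∀ j, r j a = τ * if j = i then 1 else 0 := hlift fun j ↦ if j = i then 1 else 0
  choose x hx using hx
  let _ : Algebra R (A ⧸ I) := ((Ideal.Quotient.mk I).comp φ).toAlgebra
  have hsmul (s : R) (a : A) : s • Ideal.Quotient.mk I a = Ideal.Quotient.mk I (φ s * a) := rfl
  let L : R × (ι → R) →ₗ[R] A ⧸ I :=
    (LinearMap.toSpanSingleton R (A ⧸ I) 1).coprod
      (Fintype.linearCombination R fun i ↦ Ideal.Quotient.mk I (x i))
  refine Module.Finite.of_surjective L fun m ↦ ?_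
  obtain ⟨a, rfl⟩ := Ideal.Quotient.mk_surjective m
  obtain ⟨c, hc⟩ := hconst a
  choose t ht using hc
  choose s hs using fun i ↦ hψ i (t i)
  refine ⟨(c, s), ?_⟩
  rw [LinearMap.coprod_apply, LinearMap.toSpanSingleton_apply, Fintype.linearCombination_apply,
    ← map_one (Ideal.Quotient.mk I), hsmul]
  simp only [hsmul]
  rw [← map_sum, ← map_add, Ideal.Quotient.eq, hI]
  intro i
  rw [map_sub, map_add, map_sum, Finset.sum_eq_single i]
  · have h1 := ht i
    have h2 := hs i
    rw [map_sub] at h1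
    simp only [RingHom.comp_apply] at h2
    rw [map_mul, map_mul, hx, h2, map_one, if_pos rfl]
    linear_combination -h1
  · intro j _ hj
    rw [map_mul, hx, if_neg (Ne.symm hj), mul_zero, mul_zero]
  · simp

/-- Each axis embeds as the plane curve `q i = 0`, so its contribution to the length is the order of
`q i`, and orders add. -/
theorem isDivSuppEquation_prod [IsDomain R] (hI : ∀ a, a ∈ I ↔ ∀ i, r i a = 0)
    (hlift : ∀ h : ι → T, ∃ a, ∀ i, r i a = τ * h i) (h : IsPlanePoint u v)
    (hu : ∀ i, τ ∣ r i (φ u)) (hv : ∀ i, τ ∣ r i (φ v))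
    (hψ : ∀ i, Function.Surjective ((r i).comp φ)) {q : ι → R} (hq0 : ∀ i, q i ≠ 0)
    (hq : ∀ i, RingHom.ker ((r i).comp φ) = Ideal.span {q i}) :
    @IsDivSuppEquation R (A ⧸ I) _ _
        (Module.compHom (A ⧸ I) ((Ideal.Quotient.mk I).comp φ)) (∏ i, q i) := by
  classical
  intro p hp hp1
  let _ : Module R (A ⧸ I) := Module.compHom (A ⧸ I) ((Ideal.Quotient.mk I).comp φ)
  -- A height one prime containing the prime element `u` is generated by it, and `u` does not divide
  -- `v`.
  have hnot : ¬ (u ∈ p ∧ v ∈ p) := by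
    rintro ⟨h1, h2⟩
    rw [p.eq_span_singleton_of_height_eq_one hp1 h1 h.prime, Ideal.mem_span_singleton] at h2
    exact h.not_dvd h2
  rw [length_localizedModule_quotient hI hlift hu hv p hnot fun x m ↦ rfl]
  change Ring.ord _ _ = _
  have hinj := IsLocalization.injective (Localization.AtPrime p) p.primeCompl_le_nonZeroDivisors
  have hq' (i : ι) : algebraMap R (Localization.AtPrime p) (q i) ∈ nonZeroDivisors _ :=
    mem_nonZeroDivisors_of_ne_zero ((map_ne_zero_iff _ hinj).2 (hq0 i))
  have key (s : Finset ι) :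
      Ring.ord (Localization.AtPrime p) (algebraMap R (Localization.AtPrime p) (∏ i ∈ s, q i)) =
        ∑ i ∈ s, Ring.ord (Localization.AtPrime p)
          (algebraMap R (Localization.AtPrime p) (q i)) := by
    induction s using Finset.induction_on with
    | empty => simp
    | insert i s hi ih =>
      rw [Finset.prod_insert hi, Finset.sum_insert hi, map_mul, Ring.ord_mul' _ (hq' i), ih]
  rw [key]
  exact Finset.sum_congr rfl fun i _ ↦
    (length_localizedModule_eq_ord (Along.smul_eq ((r i).comp φ)) (hψ i) (hq i) p).symm

theorem isChowEquation_pow_mul_pow [IsDomain R] [DecidableEq ι]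
    (hI : ∀ a, a ∈ I ↔ ∀ i, r i a = 0) (hlift : ∀ h : ι → T, ∃ a, ∀ i, r i a = τ * h i)
    (hconst : ∀ a, ∃ c, ∀ i, τ ∣ r i (a - φ c)) (h : IsPlanePoint u v) (hv : v ≠ 0)
    (hu' : ∀ i, τ ∣ r i (φ u)) (hv' : ∀ i, τ ∣ r i (φ v)) (S : Finset ι)
    (hψ : ∀ i, Function.Surjective ((r i).comp φ))
    (hS : ∀ i ∈ S, RingHom.ker ((r i).comp φ) = Ideal.span {v})
    (hS' : ∀ i ∈ Sᶜ, RingHom.ker ((r i).comp φ) = Ideal.span {u}) :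
    IsChowEquation φ I (φ u ^ Sᶜ.card * φ v ^ S.card) := by
  refine ⟨finite_of_surjective_on_axes hI hlift hconst hψ, ∏ i, if i ∈ S then v else u,
    isDivSuppEquation_prod hI hlift h hu' hv' hψ (fun i ↦ ?_) fun i ↦ ?_, ?_⟩
  · split_ifs
    exacts [hv, h.prime.ne_zero]
  · split_ifs with hi
    exacts [hS i hi, hS' i (Finset.mem_compl.2 hi)]
  · rw [← map_pow, ← map_pow, ← map_mul, ← Finset.prod_mul_prod_compl S,
      Finset.prod_congr rfl (g := fun _ ↦ v) fun i hi ↦ if_pos hi,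
      Finset.prod_congr (s₁ := Sᶜ) rfl (g := fun _ ↦ u) fun i hi ↦ if_neg (Finset.mem_compl.1 hi),
      Finset.prod_const, Finset.prod_const, mul_comm]

end Axes

/-! ### Power series rings and the formal axes -/

section PowerSeries

open MvPowerSeries

variable {k : Type*} [Field k] {n : ℕ}

/-- Assign each monomial of `g` to one element of `s` dividing it. Finiteness of `s` makes `g` a
finite combination, although it has infinitely many terms. -/
theorem mem_span_monomial_of_coeff {σ : Type*} {s : Set (σ →₀ ℕ)} (hs : s.Finite)
    {g : MvPowerSeries σ k} (hg : ∀ d, coeff d g ≠ 0 → ∃ e ∈ s, e ≤ d) :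
    g ∈ Ideal.span {x | ∃ e ∈ s, x = monomial e (1 : k)} := by
  classical
  let c (d : σ →₀ ℕ) : σ →₀ ℕ := Classical.epsilon fun e ↦ e ∈ s ∧ e ≤ d
  have hc (d : σ →₀ ℕ) (hd : coeff d g ≠ 0) : c d ∈ s ∧ c d ≤ d :=
    Classical.epsilon_spec (p := fun e ↦ e ∈ s ∧ e ≤ d) (hg d hd)
  let G (e : σ →₀ ℕ) : MvPowerSeries σ k := fun d ↦ if c (d + e) = e then coeff (d + e) g else 0
  have e : g = ∑ e ∈ hs.toFinset, monomial e (1 : k) * G e := by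
    ext d
    have h1 (e : σ →₀ ℕ) : coeff d (monomial e (1 : k) * G e) =
        if e ≤ d ∧ c d = e then coeff d g else 0 := by
      rw [coeff_monomial_mul]
      by_cases h : e ≤ d
      · rw [if_pos h, one_mul, coeff_apply]
        simp only [G, tsub_add_cancel_of_le h, h, true_and]
      · simp [h]
    rw [map_sum]
    simp only [h1]
    by_cases hd : coeff d g = 0
    · simp [hd]
    · obtain ⟨h2, h3⟩ := hc d hd
      rw [Finset.sum_eq_single_of_mem (c d) (hs.mem_toFinset.2 h2)]
      · simp [h3]
      · intro b _ hb
        rw [if_neg fun h ↦ hb h.2.symm]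
  rw [e]
  exact Ideal.sum_mem _ fun e he ↦ Ideal.mul_mem_right _ _
    (Ideal.subset_span ⟨e, hs.mem_toFinset.1 he, rfl⟩)

theorem axis_X (i j : Fin n) : axis (k := k) i (X j) = if j = i then PowerSeries.X else 0 := by
  classical
  ext m
  rw [coeff_axis, coeff_X]
  split_ifs with h1 h2 h2
  · subst h2
    have : m = 1 := Finsupp.single_injective _ h1
    subst this
    simp
  · exfalso
    have := DFunLike.congr_fun h1 j
    simp [Ne.symm h2] at this
  · subst h2
    rw [PowerSeries.coeff_X, if_neg]
    rintro rfl
    exact h1 rfl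
  · simp

theorem axis_toMvPowerSeries (i : Fin n) (h : PowerSeries k) :
    axis i (h.toMvPowerSeries i) = h :=
  killCompl_rename_app (e := ⟨fun _ : Unit ↦ i, fun _ _ _ ↦ rfl⟩) h

theorem axis_surjective (i : Fin n) : Function.Surjective (axis (k := k) i) :=
  fun h ↦ ⟨_, axis_toMvPowerSeries i h⟩

theorem exists_axis_eq_X_mul (h : Fin n → PowerSeries k) :
    ∃ a, ∀ i, axis i a = PowerSeries.X * h i := by
  refine ⟨∑ j, X j * (h j).toMvPowerSeries j, fun i ↦ ?_⟩
  rw [map_sum, Finset.sum_eq_single i]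
  · rw [map_mul, axis_X, axis_toMvPowerSeries, if_pos rfl]
  · intro j _ hj
    rw [map_mul, axis_X, if_neg hj, zero_mul]
  · simp

theorem constantCoeff_axis (i : Fin n) (a : MvPowerSeries (Fin n) k) :
    PowerSeries.coeff 0 (axis i a) = constantCoeff a := by
  rw [coeff_axis, Finsupp.single_zero, coeff_zero_eq_constantCoeff_apply]

theorem X_eq_monomial (i : Fin n) :
    (X i : MvPowerSeries (Fin n) k) = monomial (Finsupp.single i 1) 1 := rfl

theorem mem_formalAxesIdeal_iff (hn : 1 ≤ n) (a : MvPowerSeries (Fin n) k) :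
    a ∈ formalAxesIdeal k n ↔ ∀ i, axis i a = 0 := by
  constructor
  · intro h i
    rw [← RingHom.mem_ker]
    revert a
    change formalAxesIdeal k n ≤ _
    rw [formalAxesIdeal, Ideal.span_le]
    rintro _ ⟨j, l, hjl, rfl⟩
    rw [SetLike.mem_coe, RingHom.mem_ker, map_mul, axis_X, axis_X]
    split_ifs with h1 h2
    · exact absurd (h1.trans h2.symm) hjl
    all_goals simp
  · intro h
    let s : Set (Fin n →₀ ℕ) :=
      {e | ∃ i j : Fin n, i ≠ j ∧ e = Finsupp.single i 1 + Finsupp.single j 1}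
    have hs : s.Finite := by
      refine (Finsupp.finite_of_degree_eq 2).subset ?_
      rintro _ ⟨i, j, -, rfl⟩
      simp
    have h1 := mem_span_monomial_of_coeff hs (g := a) fun d hd ↦ ?_
    · refine Ideal.span_mono ?_ h1
      rintro _ ⟨_, ⟨i, j, hij, rfl⟩, rfl⟩
      refine ⟨i, j, hij, ?_⟩
      rw [X_eq_monomial, X_eq_monomial, monomial_mul_monomial, one_mul]
    · have hpure (i : Fin n) (m : ℕ) : d ≠ Finsupp.single i m := by
        rintro rfl
        rw [← coeff_axis, h i, map_zero] at hd
        exact hd rfl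
      obtain ⟨i, j, hij, hi, hj⟩ := exists_ne_zero_of_ne_single hn hpure
      exact ⟨_, ⟨i, j, hij, rfl⟩, single_add_single_le hij hi hj⟩

/-- Such maps are automatically continuous: series without terms of degree below `N` go to multiples
of `X ^ N`. Comparing with truncations reduces the claim to polynomials. -/
theorem ringHom_ext_of_X_dvd {θ θ' : MvPowerSeries (Fin n) k →+* PowerSeries k}
    (hC : ∀ c, θ (C c) = θ' (C c)) (hX : ∀ i, θ (X i) = θ' (X i))
    (hd : ∀ i, PowerSeries.X ∣ θ (X i)) : θ = θ' := by
  classical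
  have hpoly (p : MvPolynomial (Fin n) k) : θ p = θ' p := by
    refine RingHom.congr_fun (f := θ.comp MvPolynomial.coeToMvPowerSeries.ringHom)
      (g := θ'.comp MvPolynomial.coeToMvPowerSeries.ringHom)
      (MvPolynomial.ringHom_ext (fun c ↦ ?_) fun i ↦ ?_) p
    · simpa using hC c
    · simpa using hX i
  have hmon {N : ℕ} {g : MvPowerSeries (Fin n) k}
      (hg : ∀ d : Fin n →₀ ℕ, d.degree < N → coeff d g = 0)
      {η : MvPowerSeries (Fin n) k →+* PowerSeries k} (hη : ∀ i, PowerSeries.X ∣ η (X i)) :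
      PowerSeries.X ^ N ∣ η g := by
    have h1 := mem_span_monomial_of_coeff (Finsupp.finite_of_degree_eq N) (g := g) fun d h0 ↦ by
      obtain ⟨e, he, he'⟩ := d.exists_le_degree_eq N (not_lt.1 (mt (hg d) h0))
      exact ⟨e, he', he⟩
    have h2 := Ideal.mem_map_of_mem η h1
    rw [← Ideal.mem_span_singleton]
    refine (Ideal.map_le_iff_le_comap.2 (Ideal.span_le.2 ?_)) h2
    rintro _ ⟨e, he, rfl⟩
    rw [SetLike.mem_coe, Ideal.mem_comap, Ideal.mem_span_singleton]
    have h3 : (monomial e (1 : k)) = ∏ i, (X i : MvPowerSeries (Fin n) k) ^ e i := by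
      rw [monomial_one_eq, Finsupp.prod_fintype _ _ fun i ↦ pow_zero _]
    have he' : e.degree = N := he
    rw [h3, map_prod, ← he', Finsupp.degree_eq_sum, ← Finset.prod_pow_eq_pow_sum]
    refine Finset.prod_dvd_prod_of_dvd _ _ fun i _ ↦ ?_
    rw [map_pow]
    exact pow_dvd_pow_of_dvd (hη i) _
  ext g m
  let s := (Finsupp.finite_of_degree_lt (σ := Fin n) (m + 1)).toFinset
  let p := truncFinset k s g
  have hp (d : Fin n →₀ ℕ) (hd : d.degree < m + 1) : coeff d (g - (p : MvPowerSeries (Fin n) k)) = 0 := by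
    rw [map_sub, MvPolynomial.coeff_coe, coeff_truncFinset_of_mem, sub_self]
    simpa [s] using hd
  have h1 := PowerSeries.X_pow_dvd_iff.1 (hmon hp hd) m (Nat.lt_succ_self m)
  have h2 := PowerSeries.X_pow_dvd_iff.1 (hmon hp fun i ↦ hX i ▸ hd i) m (Nat.lt_succ_self m)
  rw [map_sub, map_sub, sub_eq_zero] at h1 h2
  rw [h1, h2, hpoly]

theorem isPrincipalIdealRing_mvPowerSeries_fin_one (k : Type*) [Field k] :
    IsPrincipalIdealRing (MvPowerSeries (Fin 1) k) :=
  IsPrincipalIdealRing.of_surjective (renameEquiv k (Equiv.ofUnique Unit (Fin 1))).toRingHom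
    (renameEquiv k (Equiv.ofUnique Unit (Fin 1))).surjective

/-- Series in two variables are series in one variable over a principal ideal domain. -/
instance uniqueFactorizationMonoid_mvPowerSeries_fin_two (k : Type*) [Field k] :
    UniqueFactorizationMonoid (MvPowerSeries (Fin 2) k) :=
  have := isPrincipalIdealRing_mvPowerSeries_fin_one k
  have : IsDomain (MvPowerSeries (Fin 1) k) := NoZeroDivisors.to_isDomain _
  (finSuccEquiv k 1).symm.toMulEquiv.uniqueFactorizationMonoid inferInstance

theorem ker_axis_fin_two (i j : Fin 2) (hij : i ≠ j) :
    RingHom.ker (axis (k := k) i) = Ideal.span {X j} := by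
  apply le_antisymm
  · intro g hg
    have h1 := mem_span_monomial_of_coeff (Set.finite_singleton (Finsupp.single j 1)) (g := g)
      fun d hd ↦ ?_
    · simpa [X_eq_monomial] using h1
    · refine ⟨_, rfl, ?_⟩
      rw [Finsupp.single_le_iff, Nat.one_le_iff_ne_zero]
      intro h0
      have : d = Finsupp.single i (d i) := by
        ext l
        by_cases hl : l = i
        · subst hl; simp
        · have : l = j := by omega
          subst this
          rw [h0, Finsupp.single_eq_of_ne hl]
      rw [this, ← coeff_axis, (RingHom.mem_ker).1 hg, map_zero] at hd
      exact hd rfl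
  · rw [Ideal.span_singleton_le_iff_mem, RingHom.mem_ker, axis_X, if_neg hij.symm]

theorem prime_X_fin_two (j : Fin 2) : Prime (X j : MvPowerSeries (Fin 2) k) := by
  obtain ⟨i, hij⟩ := exists_ne j
  have h0 : (X j : MvPowerSeries (Fin 2) k) ≠ 0 := by
    intro h
    have := congrArg (axis (k := k) j) h
    rw [axis_X, if_pos rfl, map_zero] at this
    exact PowerSeries.X_ne_zero this
  rw [← Ideal.span_singleton_prime h0, ← ker_axis_fin_two i j hij]
  exact RingHom.ker_isPrime _

theorem isPlanePoint_mvPowerSeries :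
    IsPlanePoint (X 0 : MvPowerSeries (Fin 2) k) (X 1) where
  isMaximal := by
    have h : Ideal.span {X 0, X 1} =
        RingHom.ker (constantCoeff : MvPowerSeries (Fin 2) k →+* k) := by
      apply le_antisymm
      · rw [Ideal.span_le]
        rintro _ (rfl | rfl) <;> simp [RingHom.mem_ker]
      · intro g hg
        have h1 := mem_span_monomial_of_coeff
          (Set.toFinite {Finsupp.single (0 : Fin 2) 1, Finsupp.single 1 1}) (g := g) fun d hd ↦ ?_
        · refine Ideal.span_mono ?_ h1
          rintro _ ⟨_, rfl | rfl, rfl⟩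
          · exact Or.inl rfl
          · exact Or.inr rfl
        · by_contra! h0
          have h2 := h0 _ (Or.inl rfl)
          have h3 := h0 _ (Or.inr rfl)
          rw [Finsupp.single_le_iff] at h2 h3
          have : d = 0 := by
            ext l
            fin_cases l
            · simpa using h2
            · simpa using h3
          rw [this, coeff_zero_eq_constantCoeff_apply] at hd
          exact hd hg
    rw [h]
    exact RingHom.ker_isMaximal_of_surjective _ fun c ↦ ⟨C c, constantCoeff_C c⟩
  prime := prime_X_fin_two 0
  not_dvd h := by
    have := map_dvd (axis (k := k) 1) h
    rw [axis_X, axis_X, if_neg (by decide), if_pos rfl, zero_dvd_iff] at this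
    exact PowerSeries.X_ne_zero this

end PowerSeries

section Exponents

theorem exists_sums_eq_card {n : ℕ} (hn : 1 ≤ n) {d : Fin n →₀ ℕ} (hd : d ∈ axesExponents n) :
    ∃ S : Finset (Fin n), ∑ i ∈ S, d i = Sᶜ.card ∧ ∑ i ∈ Sᶜ, d i = S.card ∧
      Sᶜ.card < n ∧ S.card < n := by
  obtain ⟨S, hS, h1, h2⟩ := exists_sum_add_card_eq hn hd
  have h3 := S.card_add_card_compl
  have h4 := Finset.sum_add_sum_compl S d
  have h5 := hd.1
  rw [Finsupp.degree_eq_sum] at h5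
  rw [Fintype.card_fin] at h3
  exact ⟨S, by omega, by omega, by omega, h2⟩

end Exponents

/-! ### The formal germ of the axes -/

section Analytic

open MvPowerSeries

variable {k : Type*} [Field k] {n : ℕ}

theorem axis_sum_smul_X (i : Fin n) (S : Finset (Fin n)) (y : Fin n → k) :
    axis i (∑ j ∈ S, y j • (X j : MvPowerSeries (Fin n) k)) =
      if i ∈ S then PowerSeries.C (y i) * PowerSeries.X else 0 := by
  classical
  rw [map_sum]
  simp only [map_smul, axis_X, smul_ite, smul_zero, PowerSeries.smul_eq_C_mul]
  exact Finset.sum_ite_eq' S i _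

theorem analyticChowIdeal_formalAxesIdeal_le (hn : 1 ≤ n) (hk : ((n - 1).factorial : k) ≠ 0) :
    analyticChowIdeal (formalAxesIdeal k n) ≤
      Ideal.span {g | ∃ d ∈ axesExponents n, g = monomial d (1 : k)} := by
  have : IsDomain (MvPowerSeries (Fin 2) k) := NoZeroDivisors.to_isDomain _
  rw [analyticChowIdeal, Ideal.span_le]
  rintro _ ⟨P, hP, hfin, f, hf, rfl⟩
  have hs := hasSubst_of_constantCoeff_zero hP
  refine mem_span_monomial_of_coeff
    ((Finsupp.finite_of_degree_eq n).subset fun d hd ↦ hd.1) fun d hd ↦ ?_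
  have hX (l : Fin 2) : constantCoeff (substAlgHom (R := k) hs (X l)) = 0 := by
    rw [substAlgHom_X, hP]
  exact exists_mem_axesExponents_le_of_isDivSuppEquation (T := PowerSeries k) hn hk
    (r := fun i ↦ (axis i).toRingHom) (τ := PowerSeries.X)
    (mem_formalAxesIdeal_iff hn) axis_surjective exists_axis_eq_X_mul PowerSeries.X_prime
    (RingHom.id _) (RingHom.id _) (fun _ _ ↦ rfl)
    (fun m t h ↦ PowerSeries.X_pow_dvd_iff.2 h) isPlanePoint_mvPowerSeries (hX 0) (hX 1) hfin hf hd

theorem sum_pow_mul_sum_pow_mem_analyticChowIdeal (hn : 1 ≤ n) (S : Finset (Fin n)) (y : Fin n → k)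
    (hy : ∀ i, y i ≠ 0) :
    (∑ i ∈ S, y i • (X i : MvPowerSeries (Fin n) k)) ^ Sᶜ.card *
      (∑ i ∈ Sᶜ, y i • (X i : MvPowerSeries (Fin n) k)) ^ S.card ∈
        analyticChowIdeal (formalAxesIdeal k n) := by
  classical
  have : IsDomain (MvPowerSeries (Fin 2) k) := NoZeroDivisors.to_isDomain _
  let P : Fin 2 → MvPowerSeries (Fin n) k := ![∑ i ∈ S, y i • X i, ∑ i ∈ Sᶜ, y i • X i]
  have hP (l : Fin 2) : constantCoeff (P l) = 0 := by
    fin_cases l <;> simp [P]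
  have hs := hasSubst_of_constantCoeff_zero hP
  refine Ideal.subset_span ⟨P, hP, ?_⟩
  set φ : MvPowerSeries (Fin 2) k →+* MvPowerSeries (Fin n) k :=
    (substAlgHom (R := k) hs).toRingHom
  have hφX (l : Fin 2) : φ (X l) = P l := substAlgHom_X hs l
  have hφC (c : k) : φ (C c) = C c := (substAlgHom (R := k) hs).commutes c
  have hdvd (i : Fin n) (l : Fin 2) : PowerSeries.X ∣ axis i (P l) := by
    rw [← pow_one PowerSeries.X, PowerSeries.X_pow_dvd_iff]
    intro m hm
    obtain rfl : m = 0 := by omega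
    rw [constantCoeff_axis, hP]
  -- On axis `i` the projection is a plane coordinate axis with its parameter scaled by `y i`, hence
  -- an isomorphism onto it.
  have hψ (i : Fin n) : (axis i).toRingHom.comp φ =
      (PowerSeries.rescale (y i)).comp (axis (if i ∈ S then 0 else 1)).toRingHom := by
    refine ringHom_ext_of_X_dvd (fun c ↦ ?_) (fun l ↦ ?_) fun l ↦ ?_
    · rw [RingHom.comp_apply, RingHom.comp_apply, hφC]
      change axis i (algebraMap k _ c) = PowerSeries.rescale (y i) (axis _ (algebraMap k _ c))
      rw [AlgHom.commutes, AlgHom.commutes, ← PowerSeries.coe_rescaleAlgHom, RingHom.coe_coe,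
        AlgHom.commutes]
    · rw [RingHom.comp_apply, RingHom.comp_apply, hφX]
      change axis i (P l) = PowerSeries.rescale (y i) (axis _ (X l))
      rw [axis_X]
      by_cases hi : i ∈ S <;> fin_cases l <;>
        simp [P, axis_sum_smul_X, hi, PowerSeries.rescale_X, -map_sum]
    · rw [RingHom.comp_apply, hφX]
      exact hdvd i l
  have hrinj (i : Fin n) := PowerSeries.rescale_injective (R := k) (hy i)
  have hrsurj (i : Fin n) : Function.Surjective (PowerSeries.rescale (y i)) := fun g ↦
    ⟨PowerSeries.rescale (y i)⁻¹ g, by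
      rw [PowerSeries.rescale_rescale, inv_mul_cancel₀ (hy i), PowerSeries.rescale_one,
        RingHom.id_apply]⟩
  have hker (i : Fin n) : RingHom.ker ((axis i).toRingHom.comp φ) =
      Ideal.span {X (if i ∈ S then 1 else 0)} := by
    rw [hψ, RingHom.ker_comp_of_injective _ (hrinj i)]
    exact ker_axis_fin_two _ _ (by split_ifs <;> decide)
  have key := isChowEquation_pow_mul_pow (T := PowerSeries k) (τ := PowerSeries.X) (φ := φ)
    (r := fun i ↦ (axis i).toRingHom) (mem_formalAxesIdeal_iff hn) exists_axis_eq_X_mul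
    (fun a ↦ ⟨C (constantCoeff a), fun i ↦ ?_⟩) isPlanePoint_mvPowerSeries
    (prime_X_fin_two 1).ne_zero (fun i ↦ by rw [hφX]; exact hdvd i 0)
    (fun i ↦ by rw [hφX]; exact hdvd i 1) S (fun i ↦ ?_) (fun i hi ↦ ?_) fun i hi ↦ ?_
  · simpa [hφX, P] using key
  · rw [hφC, ← pow_one PowerSeries.X, PowerSeries.X_pow_dvd_iff]
    intro m hm
    obtain rfl : m = 0 := by omega
    change PowerSeries.coeff 0 (axis i _) = 0
    rw [constantCoeff_axis, map_sub, constantCoeff_C, sub_self]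
  · rw [hψ]
    exact (hrsurj i).comp (axis_surjective _)
  · rw [hker, if_pos hi]
  · rw [hker, if_neg (Finset.mem_compl.1 hi)]

theorem span_monomial_le_analyticChowIdeal [Infinite k] (hn : 1 ≤ n)
    (hk : ((n - 1).factorial : k) ≠ 0) :
    Ideal.span {g | ∃ d ∈ axesExponents n, g = monomial d (1 : k)} ≤
      analyticChowIdeal (formalAxesIdeal k n) := by
  rw [Ideal.span_le]
  rintro _ ⟨d, hd, rfl⟩
  obtain ⟨S, h1, h2, h3, h4⟩ := exists_sums_eq_card hn hd
  rw [monomial_one_eq, Finsupp.prod_fintype _ _ fun i ↦ pow_zero _]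
  exact prod_pow_mem_of_forall_mem hk X
    ((analyticChowIdeal (formalAxesIdeal k n)).restrictScalars k) S h3 h4
    (sum_pow_mul_sum_pow_mem_analyticChowIdeal hn S) h1 h2

end Analytic

/-! ### The affine axes -/

section Polynomial

open MvPolynomial

variable {k : Type*} [Field k] {n : ℕ}

/-- The restriction of a polynomial to the `i`-th coordinate axis. -/
def polyAxis (i : Fin n) : MvPolynomial (Fin n) k →ₐ[k] Polynomial k :=
  aeval fun j ↦ if j = i then Polynomial.X else 0

theorem polyAxis_X (i j : Fin n) :
    polyAxis (k := k) i (X j) = if j = i then Polynomial.X else 0 :=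
  aeval_X _ _

theorem axis_coe (i : Fin n) (p : MvPolynomial (Fin n) k) :
    axis i (p : MvPowerSeries (Fin n) k) = (polyAxis i p : Polynomial k) := by
  refine RingHom.congr_fun (f := (axis i).toRingHom.comp coeToMvPowerSeries.ringHom)
    (g := Polynomial.coeToPowerSeries.ringHom.comp (polyAxis i).toRingHom)
    (ringHom_ext (fun c ↦ ?_) fun j ↦ ?_) p
  · simp only [RingHom.comp_apply, coeToMvPowerSeries.ringHom_apply, coe_C,
      Polynomial.coeToPowerSeries.ringHom_apply]
    change axis i (algebraMap k _ c) =
      ((polyAxis i (algebraMap k _ c) : Polynomial k) : PowerSeries k)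
    rw [AlgHom.commutes, AlgHom.commutes]
    exact (Polynomial.coe_C c).symm
  · simp only [RingHom.comp_apply, coeToMvPowerSeries.ringHom_apply, coe_X,
      Polynomial.coeToPowerSeries.ringHom_apply]
    change axis i (MvPowerSeries.X j) = ((polyAxis i (X j) : Polynomial k) : PowerSeries k)
    rw [axis_X, polyAxis_X]
    split_ifs <;> simp

theorem coeff_polyAxis (i : Fin n) (p : MvPolynomial (Fin n) k) (m : ℕ) :
    (polyAxis i p).coeff m = coeff (Finsupp.single i m) p := by
  rw [← Polynomial.coeff_coe, ← axis_coe, coeff_axis, coeff_coe]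

theorem polyAxis_aeval_X (i : Fin n) (h : Polynomial k) :
    polyAxis i (Polynomial.aeval (X i) h) = h := by
  rw [← Polynomial.aeval_algHom_apply, polyAxis_X, if_pos rfl, Polynomial.aeval_X_left_apply]

theorem polyAxis_surjective (i : Fin n) : Function.Surjective (polyAxis (k := k) i) :=
  fun h ↦ ⟨_, polyAxis_aeval_X i h⟩

theorem exists_polyAxis_eq_X_mul (h : Fin n → Polynomial k) :
    ∃ a, ∀ i, polyAxis i a = Polynomial.X * h i := by
  refine ⟨∑ j, X j * Polynomial.aeval (X j) (h j), fun i ↦ ?_⟩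
  rw [map_sum, Finset.sum_eq_single i]
  · rw [map_mul, polyAxis_X, polyAxis_aeval_X, if_pos rfl]
  · intro j _ hj
    rw [map_mul, polyAxis_X, if_neg hj, zero_mul]
  · simp

theorem mem_axesIdeal_iff (hn : 1 ≤ n) (a : MvPolynomial (Fin n) k) :
    a ∈ axesIdeal k n ↔ ∀ i, polyAxis i a = 0 := by
  constructor
  · intro h i
    rw [← RingHom.mem_ker]
    revert a
    change axesIdeal k n ≤ _
    rw [axesIdeal, Ideal.span_le]
    rintro _ ⟨j, l, hjl, rfl⟩
    rw [SetLike.mem_coe, RingHom.mem_ker, map_mul, polyAxis_X, polyAxis_X]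
    split_ifs with h1 h2
    · exact absurd (h1.trans h2.symm) hjl
    all_goals simp
  · intro h
    have h1 := (mem_ideal_span_monomial_image (x := a) (s := {e : Fin n →₀ ℕ |
      ∃ i j : Fin n, i ≠ j ∧ e = Finsupp.single i 1 + Finsupp.single j 1})).2 fun d hd ↦ ?_
    · refine Ideal.span_mono ?_ h1
      rintro _ ⟨_, ⟨i, j, hij, rfl⟩, rfl⟩
      refine ⟨i, j, hij, ?_⟩
      simp only [X, monomial_mul, one_mul]
    · rw [mem_support_iff] at hd
      have hpure (i : Fin n) (m : ℕ) : d ≠ Finsupp.single i m := by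
        rintro rfl
        rw [← coeff_polyAxis, h i] at hd
        exact hd rfl
      obtain ⟨i, j, hij, hi, hj⟩ := exists_ne_zero_of_ne_single hn hpure
      exact ⟨_, ⟨i, j, hij, rfl⟩, single_add_single_le hij hi hj⟩

theorem IsPlanePoint.map {R R' : Type*} [CommRing R] [CommRing R'] {u v : R}
    (h : IsPlanePoint u v) (e : R ≃+* R') : IsPlanePoint (e u) (e v) where
  isMaximal := by
    have := h.isMaximal
    rw [← Set.image_pair, ← Ideal.map_span]
    exact Ideal.map_isMaximal_of_equiv e
  prime := (MulEquiv.prime_iff e).2 h.prime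
  not_dvd := by
    rw [map_dvd_iff]
    exact h.not_dvd

theorem isPlanePoint_X : IsPlanePoint (X 0 : MvPolynomial (Fin 2) k) (X 1) where
  isMaximal := by
    have h : Ideal.span {X 0, X 1} =
        RingHom.ker (constantCoeff : MvPolynomial (Fin 2) k →+* k) := by
      apply le_antisymm
      · rw [Ideal.span_le]
        rintro _ (rfl | rfl) <;> simp [RingHom.mem_ker]
      · intro g hg
        rw [← Set.image_pair (X : Fin 2 → MvPolynomial (Fin 2) k), mem_ideal_span_X_image]
        intro d hd
        by_contra! h0
        have : d = 0 := by
          ext l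
          fin_cases l
          · simpa using h0 0 (Or.inl rfl)
          · simpa using h0 1 (Or.inr rfl)
        rw [mem_support_iff, this] at hd
        exact hd hg
    rw [h]
    exact RingHom.ker_isMaximal_of_surjective _ fun c ↦ ⟨C c, constantCoeff_C _ c⟩
  prime := X_prime
  not_dvd := by
    rw [X_dvd_X]
    simp

theorem isPlanePoint_X_sub_C (c : Fin 2 → k) :
    IsPlanePoint (X 0 - C (c 0) : MvPolynomial (Fin 2) k) (X 1 - C (c 1)) := by
  let e : MvPolynomial (Fin 2) k ≃ₐ[k] MvPolynomial (Fin 2) k :=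
    AlgEquiv.ofAlgHom (aeval fun i ↦ X i - C (c i)) (aeval fun i ↦ X i + C (c i))
      (by ext i; simp [← algebraMap_eq]) (by ext i; simp [← algebraMap_eq])
  have := isPlanePoint_X.map e.toRingEquiv
  simpa [e] using this

theorem ker_polyAxis_fin_two (i j : Fin 2) (hij : i ≠ j) :
    RingHom.ker (polyAxis (k := k) i) = Ideal.span {X j} := by
  apply le_antisymm
  · intro g hg
    rw [← Set.image_singleton, mem_ideal_span_X_image]
    refine fun d hd ↦ ⟨j, rfl, fun h0 ↦ ?_⟩
    have : d = Finsupp.single i (d i) := by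
      ext l
      by_cases hl : l = i
      · subst hl; simp
      · have : l = j := by omega
        subst this
        rw [h0, Finsupp.single_eq_of_ne hl]
    rw [mem_support_iff, this, ← coeff_polyAxis, (RingHom.mem_ker).1 hg] at hd
    exact hd rfl
  · rw [Ideal.span_singleton_le_iff_mem, RingHom.mem_ker, polyAxis_X, if_neg hij.symm]

theorem polyAxis_sum_smul_X (i : Fin n) (S : Finset (Fin n)) (y : Fin n → k) :
    polyAxis i (∑ j ∈ S, y j • (X j : MvPolynomial (Fin n) k)) =
      if i ∈ S then Polynomial.C (y i) * Polynomial.X else 0 := by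
  classical
  rw [map_sum]
  simp only [map_smul, polyAxis_X, smul_ite, smul_zero, Polynomial.smul_eq_C_mul]
  exact Finset.sum_ite_eq' S i _

theorem polynomialChowIdeal_axesIdeal_le (hn : 1 ≤ n) (hk : ((n - 1).factorial : k) ≠ 0) :
    polynomialChowIdeal (axesIdeal k n) ≤
      Ideal.span {g | ∃ d ∈ axesExponents n, g = monomial d (1 : k)} := by
  rw [polynomialChowIdeal, Ideal.span_le]
  rintro _ ⟨P, hfin, f, hf, rfl⟩
  have himage : {g | ∃ d ∈ axesExponents n, g = monomial d (1 : k)} =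
      (fun d ↦ monomial d (1 : k)) '' axesExponents n := by
    ext g
    simp [eq_comm]
  rw [himage, SetLike.mem_coe, mem_ideal_span_monomial_image]
  intro d hd
  rw [mem_support_iff, ← coeff_coe] at hd
  -- A polynomial map may move the origin, so the plane coordinates are recentred at its image.
  have hX (l : Fin 2) : MvPowerSeries.constantCoeff (coeToMvPowerSeries.ringHom
      ((aeval P : MvPolynomial (Fin 2) k →ₐ[k] MvPolynomial (Fin n) k).toRingHom
        (X l - C (constantCoeff (P l))))) = 0 := by
    change MvPowerSeries.constantCoeff ((aeval P (X l - C (constantCoeff (P l))) :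
      MvPolynomial (Fin n) k) : MvPowerSeries (Fin n) k) = 0
    rw [← MvPowerSeries.coeff_zero_eq_constantCoeff_apply, coeff_coe, map_sub, aeval_X,
      aeval_C, algebraMap_eq, coeff_sub, coeff_C, if_pos rfl, constantCoeff_eq, sub_self]
  exact exists_mem_axesExponents_le_of_isDivSuppEquation (T := Polynomial k) hn hk
    (r := fun i ↦ (polyAxis i).toRingHom) (τ := Polynomial.X)
    (mem_axesIdeal_iff hn) polyAxis_surjective exists_polyAxis_eq_X_mul Polynomial.prime_X
    coeToMvPowerSeries.ringHom Polynomial.coeToPowerSeries.ringHom axis_coe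
    (fun m t h ↦ Polynomial.X_pow_dvd_iff.2 fun l hl ↦ by
      rw [← Polynomial.coeff_coe]; exact h l hl)
    (isPlanePoint_X_sub_C fun l ↦ constantCoeff (P l)) (hX 0) (hX 1) hfin hf hd

theorem sum_pow_mul_sum_pow_mem_linearChowIdeal (hn : 1 ≤ n) (S : Finset (Fin n)) (y : Fin n → k)
    (hy : ∀ i, y i ≠ 0) :
    (∑ i ∈ S, y i • (X i : MvPolynomial (Fin n) k)) ^ Sᶜ.card *
      (∑ i ∈ Sᶜ, y i • (X i : MvPolynomial (Fin n) k)) ^ S.card ∈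
        linearChowIdeal (axesIdeal k n) := by
  classical
  let P : Fin 2 → MvPolynomial (Fin n) k := ![∑ i ∈ S, y i • X i, ∑ i ∈ Sᶜ, y i • X i]
  have hhom (S : Finset (Fin n)) : (∑ i ∈ S, y i • (X i : MvPolynomial (Fin n) k)).IsHomogeneous 1 :=
    IsHomogeneous.sum _ _ _ fun i _ ↦
      (homogeneousSubmodule (Fin n) k 1).smul_mem (y i) (isHomogeneous_X k i)
  have hP (l : Fin 2) : (P l).IsHomogeneous 1 := by
    fin_cases l
    exacts [hhom S, hhom Sᶜ]
  refine Ideal.subset_span ⟨P, hP, ?_⟩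
  set φ : MvPolynomial (Fin 2) k →+* MvPolynomial (Fin n) k :=
    (aeval P : MvPolynomial (Fin 2) k →ₐ[k] MvPolynomial (Fin n) k).toRingHom
  have hφX (l : Fin 2) : φ (X l) = P l := aeval_X P l
  have hφC (c : k) : φ (C c) = C c :=
    (aeval P : MvPolynomial (Fin 2) k →ₐ[k] MvPolynomial (Fin n) k).commutes c
  -- Rescaling of the parameter by `y i`; `σ'` is its inverse.
  let σ (i : Fin n) : Polynomial k →ₐ[k] Polynomial k :=
    Polynomial.aeval (Polynomial.C (y i) * Polynomial.X)
  let σ' (i : Fin n) : Polynomial k →ₐ[k] Polynomial k :=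
    Polynomial.aeval (Polynomial.C (y i)⁻¹ * Polynomial.X)
  have hσ (i : Fin n) (g : Polynomial k) : σ i (σ' i g) = g := by
    refine AlgHom.congr_fun (φ₁ := (σ i).comp (σ' i)) (φ₂ := AlgHom.id k _)
      (Polynomial.algHom_ext ?_) g
    simp [σ, σ', ← mul_assoc, ← Polynomial.C_mul, hy i]
  have hσ' (i : Fin n) (g : Polynomial k) : σ' i (σ i g) = g := by
    refine AlgHom.congr_fun (φ₁ := (σ' i).comp (σ i)) (φ₂ := AlgHom.id k _)
      (Polynomial.algHom_ext ?_) g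
    simp [σ, σ', ← mul_assoc, ← Polynomial.C_mul, hy i]
  have hψ (i : Fin n) : (polyAxis i).toRingHom.comp φ =
      (σ i).toRingHom.comp (polyAxis (if i ∈ S then 0 else 1)).toRingHom := by
    refine ringHom_ext (fun c ↦ ?_) fun l ↦ ?_
    · rw [RingHom.comp_apply, RingHom.comp_apply, hφC]
      change polyAxis i (algebraMap k _ c) = σ i (polyAxis _ (algebraMap k _ c))
      rw [AlgHom.commutes, AlgHom.commutes, AlgHom.commutes]
    · rw [RingHom.comp_apply, RingHom.comp_apply, hφX]
      change polyAxis i (P l) = σ i (polyAxis _ (X l))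
      rw [polyAxis_X]
      by_cases hi : i ∈ S <;> fin_cases l <;>
        simp [P, polyAxis_sum_smul_X, hi, σ, -map_sum]
  have hdvd (i : Fin n) (l : Fin 2) : Polynomial.X ∣ polyAxis i (P l) := by
    fin_cases l
    all_goals
      simp only [P, polyAxis_sum_smul_X, Fin.mk_one, Fin.zero_eta, Matrix.cons_val_zero,
        Matrix.cons_val_one]
      split_ifs
      exacts [dvd_mul_left _ _, dvd_zero _]
  have hker (i : Fin n) : RingHom.ker ((polyAxis i).toRingHom.comp φ) =
      Ideal.span {X (if i ∈ S then 1 else 0)} := by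
    rw [hψ, RingHom.ker_comp_of_injective _ (Function.LeftInverse.injective (hσ' i))]
    exact ker_polyAxis_fin_two _ _ (by split_ifs <;> decide)
  have key := isChowEquation_pow_mul_pow (T := Polynomial k) (τ := Polynomial.X) (φ := φ)
    (r := fun i ↦ (polyAxis i).toRingHom) (mem_axesIdeal_iff hn) exists_polyAxis_eq_X_mul
    (fun a ↦ ⟨C (constantCoeff a), fun i ↦ ?_⟩) isPlanePoint_X
    (X_ne_zero 1) (fun i ↦ by rw [hφX]; exact hdvd i 0)
    (fun i ↦ by rw [hφX]; exact hdvd i 1) S (fun i ↦ ?_) (fun i hi ↦ ?_) fun i hi ↦ ?_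
  · simpa [hφX, P] using key
  · rw [hφC, Polynomial.X_dvd_iff]
    change (polyAxis i _).coeff 0 = 0
    rw [coeff_polyAxis, Finsupp.single_zero, ← constantCoeff_eq, map_sub, constantCoeff_C, sub_self]
  · rw [hψ]
    exact (Function.RightInverse.surjective (hσ i)).comp (polyAxis_surjective _)
  · rw [hker, if_pos hi]
  · rw [hker, if_neg (Finset.mem_compl.1 hi)]

theorem span_monomial_le_linearChowIdeal [Infinite k] (hn : 1 ≤ n)
    (hk : ((n - 1).factorial : k) ≠ 0) :
    Ideal.span {g | ∃ d ∈ axesExponents n, g = monomial d (1 : k)} ≤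
      linearChowIdeal (axesIdeal k n) := by
  rw [Ideal.span_le]
  rintro _ ⟨d, hd, rfl⟩
  obtain ⟨S, h1, h2, h3, h4⟩ := exists_sums_eq_card hn hd
  rw [monomial_eq, C_1, one_mul, Finsupp.prod_fintype _ _ fun i ↦ pow_zero _]
  exact prod_pow_mem_of_forall_mem hk X
    ((linearChowIdeal (axesIdeal k n)).restrictScalars k) S h3 h4
    (sum_pow_mul_sum_pow_mem_linearChowIdeal hn S) h1 h2

theorem linearChowIdeal_le_polynomialChowIdeal (I : Ideal (MvPolynomial (Fin n) k)) :
    linearChowIdeal I ≤ polynomialChowIdeal I :=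
  Ideal.span_mono fun _ ⟨P, _, h⟩ ↦ ⟨P, h⟩

end Polynomial

end ChowAxes

end

theorem propositionI (k : Type*) [Field k] [Infinite k] (n : ℕ) (hn : 1 ≤ n)
    (hk : ((n - 1).factorial : k) ≠ 0) :
    ChowAxes.linearChowIdeal (ChowAxes.axesIdeal k n) =
        Ideal.span {g | ∃ d ∈ ChowAxes.axesExponents n, g = MvPolynomial.monomial d (1 : k)} ∧
      ChowAxes.polynomialChowIdeal (ChowAxes.axesIdeal k n) =
        Ideal.span {g | ∃ d ∈ ChowAxes.axesExponents n, g = MvPolynomial.monomial d (1 : k)} ∧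
      ChowAxes.analyticChowIdeal (ChowAxes.formalAxesIdeal k n) =
        Ideal.span {g | ∃ d ∈ ChowAxes.axesExponents n,
          g = MvPowerSeries.monomial d (1 : k)} :=
  have h₁ := ChowAxes.span_monomial_le_linearChowIdeal hn hk
  have h₂ := ChowAxes.linearChowIdeal_le_polynomialChowIdeal (ChowAxes.axesIdeal k n)
  have h₃ := ChowAxes.polynomialChowIdeal_axesIdeal_le hn hk
  -- The linear ideal lies in the polynomial one, so the lower bound for linear maps and the upper
  -- bound for polynomial maps settle both.
  ⟨(h₂.trans h₃).antisymm h₁, h₃.antisymm (h₁.trans h₂),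
    (ChowAxes.analyticChowIdeal_formalAxesIdeal_le hn hk).antisymm
      (ChowAxes.span_monomial_le_analyticChowIdeal hn hk)⟩
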